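/- Fix $n\ge 1$ and a partition $\lambda=(\lambda_1\ge\dots\ge\lambda_n=0)$ of non-negative integers, with column lengths $c_1\ge\dots\ge c_{\lambda_1}$. Let $\mathcal T_\lambda$ be the set of semistandard tableaux of shape $\lambda$ with entries in $[n]=\{1,\dots,n\}$ (rows weakly increasing, columns strictly increasing). Write $\phi\in S_n$ in one-rowed form $(\phi_1,\dots,\phi_n)$, and let $S_n^\lambda$ be the set of $\phi\in S_n$ such that $\phi_a<\phi_b$ whenever $a<b$ and there is no $j$ with $a\le c_j<b$. For $\phi\in S_n$ let $Y_\lambda(\phi)$ be the filling of $\lambda$ whose $j$-th column consists of $\phi_1,\dots,\phi_{c_j}$ in increasing order. For $T\in\mathcal T_\lambda$ let $R(T)$ be its (Lascoux--Schützenberger) right key: the $j$-th column of $R(T)$ is the rightmost column of the skew tableau obtained from the columns $j,j+1,\dots,\lambda_1$ of $T$ by successively moving the column length $c_j$ to the far right, interchanging lengths of adjacent columns by jeu de taquin. Let $S(T)$ be the scanning tableau of $T$: for each $j$, restrict to columns $j,\dots,\lambda_1$ and, for $i=c_j,c_j-1,\dots,1$, form the sequence of the values in the lowest boxes of the (non-empty)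 columns from left to right, take its earliest weakly increasing subsequence (start with the first value, and repeatedly take the next value that is at least the last one taken), let the entry $S(T;j,i)$ in column $j$ and row $i$ of $S(T)$ be its final value, and delete the boxes of this subsequence. Put, with entrywise comparison, $$\mathcal D_{\lambda,w}=\{T\in\mathcal T_\lambda : R(T)\le Y_\lambda(w)\}.$$ For $c\in[n-1]$ let $\Gamma(c)=((c,c+1),(c,c+2),\dots,(c,n),(c-1,c+1),\dots,(c-1,n),\dots,(1,c+1),\dots,(1,n))$, and let $\Gamma(\lambda)$ be the concatenation of $\Gamma(c_1),\dots,\Gamma(c_{\lambda_1})$, a list of $x$ transpositions. A subset $J\subseteq[x]$ determines a chain of permutations: start with the identity and apply in order the transpositions of $\Gamma(\lambda)$ with index in $J$, where $(i,k)$ interchanges the entries in positions $i$ and $k$. The set $J$ is admissible if this chain is saturated in the Bruhat order, that is, if each step increases the number of inversions by exactly one. Let $\mathrm{Ad}(\lambda,w)$ be the set of admissible $J$ whose chain ends in a permutation $\le w$ in the Bruhat order. For $J \in \mathrm{Ad}(\lambda,w)$ let $T_J$ be the filling of $\lambda$ whose $j$-th column consists of the first $c_j$ entries, in increasing order, of the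 permutation reached after the segments $\Gamma(c_1),\dots,\Gamma(c_j)$, and put $\mathcal A_{\lambda,w}=\{T_J : J\in\mathrm{Ad}(\lambda,w)\}$. Then for every $w\in S_n^\lambda$ $$\mathcal D_{\lambda,w}=\{T\in\mathcal T_\lambda : S(T)\le Y_\lambda(w)\}=\mathcal A_{\lambda,w}.$$ In particular every $T_J$ with $J\in\mathrm{Ad}(\lambda,w)$ is a semistandard tableau with entries in $[n]$. -/

import Mathlib

namespace Demazure

/-! Conventions: rows, columns and positions are indexed from `0`, while the letters occurring in
tableaux are the numbers `1, …, n`. A permutation `φ` of `Fin n` has one-rowed form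
`(φ 0 + 1, …, φ (n - 1) + 1)`. A box `(i, j)` lies in row `i` and column `j`. -/

/-- The set `Λ_n^+` of `n`-partitions with last part equal to zero. -/
structure DomPartition (n : ℕ) where
  parts : Fin n → ℕ
  anti : Antitone parts
  last_zero : ∀ i : Fin n, (i : ℕ) + 1 = n → parts i = 0

/-- The Young diagram of a partition: row `i` has `parts i` boxes. -/
def DomPartition.diagram {n : ℕ} (lam : DomPartition n) : YoungDiagram :=
  YoungDiagram.ofRowLens (List.ofFn lam.parts) lam.anti.sortedGE_ofFn

/-- The number of columns, `λ_1`. -/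
def DomPartition.numCols {n : ℕ} (lam : DomPartition n) : ℕ := lam.diagram.rowLen 0

/-- The length `c_j` of column `j`. -/
def DomPartition.col {n : ℕ} (lam : DomPartition n) (j : ℕ) : ℕ := lam.diagram.colLen j

/-- A filling with arbitrary values; only the values in the diagram at hand matter. -/
abbrev Filling := ℕ → ℕ → ℕ

/-- Entrywise comparison of two fillings of shape `lam`. -/
def FillingLE {n : ℕ} (lam : DomPartition n) (F G : Filling) : Prop :=
  ∀ i j : ℕ, (i, j) ∈ lam.diagram → F i j ≤ G i j

/-- `T` has all its values in `{1, …, n}`, i.e. it is an `n`-semistandard tableau. -/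
def HasLetters {n : ℕ} (lam : DomPartition n)
    (T : SemistandardYoungTableau lam.diagram) : Prop :=
  ∀ i j : ℕ, (i, j) ∈ lam.diagram → 1 ≤ T i j ∧ T i j ≤ n

/-! ### Permutations -/

section Perm

variable {n : ℕ}

/-- The number of inversions of a permutation. -/
def inversions (u : Equiv.Perm (Fin n)) : ℕ :=
  (Finset.univ.filter fun p : Fin n × Fin n => p.1 < p.2 ∧ u p.2 < u p.1).card

/-- Covering relation of the Bruhat order: `v` arises from `u` by interchanging the entries in two
positions, and has exactly one inversion more. -/
def BruhatCover (u v : Equiv.Perm (Fin n)) : Prop :=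
  (∃ a b : Fin n, v = u * Equiv.swap a b) ∧ inversions v = inversions u + 1

/-- The (strong) Bruhat order. -/
def BruhatLE (u v : Equiv.Perm (Fin n)) : Prop := Relation.ReflTransGen BruhatCover u v

/-- The set `S_n^λ`: the one-rowed form increases on each block of positions that is not
separated by a column length of `λ`. -/
def minReps (lam : DomPartition n) : Set (Equiv.Perm (Fin n)) :=
  {u | ∀ a b : Fin n, a < b →
    (¬ ∃ j < lam.numCols, (a : ℕ) < lam.col j ∧ lam.col j ≤ (b : ℕ)) → u a < u b}

/-- The set of the first `c` entries of the one-rowed form of `u`. -/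
def firstEntries (u : Equiv.Perm (Fin n)) (c : ℕ) : Finset ℕ :=
  (Finset.univ.filter fun k : Fin n => (k : ℕ) < c).image fun k => (u k : ℕ) + 1

/-- The `i`-th smallest (counting from `0`) among the first `c` entries of `u`. -/
def sortedEntry (u : Equiv.Perm (Fin n)) (c i : ℕ) : ℕ :=
  ((firstEntries u c).sort (· ≤ ·)).getD i 0

/-- The `λ`-key `Y_λ(u)`: each column of length `c` consists of the first `c` entries of `u` in
increasing order. -/
def keyOf (lam : DomPartition n) (u : Equiv.Perm (Fin n)) : Filling :=
  fun i j => sortedEntry u (lam.col j) i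

end Perm

/-! ### The right key

Columns are lists of values read from bottom to top. -/

/-- Column `j` of a filling, read from bottom to top. -/
def columnUp {n : ℕ} (lam : DomPartition n) (F : Filling) (j : ℕ) : List ℕ :=
  (List.range (lam.col j)).reverse.map fun i => F i j

/-- One backward jeu de taquin slide in a skew tableau with two columns, starting at the empty box
immediately below the right column. The first list holds the values of the left column in the row
of the empty box and above, the second list those of the right column above the empty box, both
from bottom to top. The larger of the left neighbour and the upper neighbour moves into the empty
box, the upper one in case of a tie; as soon as a value of the left column has moved to the right,
the values above it in the left column drop by one row. Returns the new contents of both columns. -/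
def slide : List ℕ → List ℕ → List ℕ × List ℕ
  | [], B => ([], B)
  | a :: A, [] => (A, [a])
  | a :: A, b :: B =>
    if b < a then (A, a :: b :: B)
    else (a :: (slide A B).1, b :: (slide A B).2)

/-- `d` successive backward slides in a skew tableau with two columns whose left column reaches
exactly `d` rows below its right column. In the first slide the `d - 1` bottom values of the left
column lie below the empty box and stay in place. -/
def slides : ℕ → List ℕ → List ℕ → List ℕ × List ℕ
  | 0, A, B => (A, B)
  | d + 1, A, B => slides d (A.take d ++ (slide (A.drop d) B).1) (slide (A.drop d) B).2

/-- Given adjacent top-justified columns `A`, `B` forming a tableau, the right column of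
the skew tableau obtained by interchanging the two column lengths by jeu de taquin. -/
def moveRight (A B : List ℕ) : List ℕ := (slides (A.length - B.length) A B).2

/-- The column of the right key in place `j` (bottom to top), after Lascoux and Schützenberger: the
column length `c_j` is moved by jeu de taquin past all columns to the right of column `j`. The
outcome is the rightmost column of a frank skew tableau (one that rectifies to `F` and whose column
lengths are a rearrangement of those of `F`) in which this column has length `c_j`. -/
def rightKeyColumn {n : ℕ} (lam : DomPartition n) (F : Filling) (j : ℕ) : List ℕ :=
  ((List.range' (j + 1) (lam.numCols - (j + 1))).map (columnUp lam F)).foldl moveRight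
    (columnUp lam F j)

/-- The right key `R(F)`. -/
def rightKey {n : ℕ} (lam : DomPartition n) (F : Filling) : Filling :=
  fun i j => (rightKeyColumn lam F j).getD (lam.col j - 1 - i) 0

/-! ### The scanning tableau -/

/-- Continue a scanning path with current last value `v` through the lowest remaining boxes of the
given columns: a lowest value is appended as soon as it is at least the last value appended (the
earliest weakly increasing subsequence). Returns the final value of the path and the columns
with the boxes of the path deleted. -/
def scanFrom : ℕ → List (List ℕ) → ℕ × List (List ℕ)
  | v, [] => (v, [])
  | v, [] :: Cs => ((scanFrom v Cs).1, [] :: (scanFrom v Cs).2)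
  | v, (x :: C) :: Cs =>
    if v ≤ x then ((scanFrom x Cs).1, C :: (scanFrom x Cs).2)
    else ((scanFrom v Cs).1, (x :: C) :: (scanFrom v Cs).2)

/-- The final values of the scanning paths that begin in the column `C` (bottom to top), where
`Cs` are the columns to its right; each path is deleted before the next one is computed. -/
def scanColumn : List ℕ → List (List ℕ) → List ℕ
  | [], _ => []
  | x :: C, Cs => (scanFrom x Cs).1 :: scanColumn C (scanFrom x Cs).2

/-- The scanning tableau `S(F)`. -/
def scanningTableau {n : ℕ} (lam : DomPartition n) (F : Filling) : Filling :=
  fun i j =>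
    (scanColumn (columnUp lam F j)
      ((List.range' (j + 1) (lam.numCols - (j + 1))).map (columnUp lam F))).getD
      (lam.col j - 1 - i) 0

/-! ### Admissible subsets -/

section Alcove

variable {n : ℕ}

/-- `Γ(c) = ((c, c+1), …, (c, n), (c-1, c+1), …, (c-1, n), …, (1, c+1), …, (1, n))`, with positions
shifted to start from `0`. -/
def gammaCol (n c : ℕ) : List (Fin n × Fin n) :=
  ((List.finRange n).filter fun i : Fin n => (i : ℕ) < c).reverse.flatMap fun i =>
    ((List.finRange n).filter fun k : Fin n => c ≤ (k : ℕ)).map fun k => (i, k)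

/-- The concatenation of `Γ(c_j)` over the first `m` columns of `λ`. -/
def gammaPrefix (lam : DomPartition n) (m : ℕ) : List (Fin n × Fin n) :=
  (List.range m).flatMap fun j => gammaCol n (lam.col j)

/-- The list `Γ(λ)`. -/
def gamma (lam : DomPartition n) : List (Fin n × Fin n) := gammaPrefix lam lam.numCols

/-- The permutation obtained from the identity by applying, in order, those among the first `m`
transpositions of `Γ(λ)` whose index is in `J`; a transposition `(i, k)` interchanges the entries
in positions `i` and `k`. -/
def chainPerm (lam : DomPartition n) (J : Finset (Fin (gamma lam).length)) :
    ℕ → Equiv.Perm (Fin n)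
  | 0 => 1
  | m + 1 =>
    if h : m < (gamma lam).length then
      if (⟨m, h⟩ : Fin (gamma lam).length) ∈ J then
        chainPerm lam J m * Equiv.swap ((gamma lam).get ⟨m, h⟩).1 ((gamma lam).get ⟨m, h⟩).2
      else chainPerm lam J m
    else chainPerm lam J m

/-- `J` is admissible: the chain of permutations it produces from the identity is a saturated chain
in the Bruhat order. -/
def Admissible (lam : DomPartition n) (J : Finset (Fin (gamma lam).length)) : Prop :=
  ∀ m ∈ J, BruhatCover (chainPerm lam J m) (chainPerm lam J (m + 1))

/-- `Ad(λ, w)`: the admissible subsets whose chain ends in a permutation at most `w` in the Bruhat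
order. -/
def Ad (lam : DomPartition n) (w : Equiv.Perm (Fin n)) :
    Set (Finset (Fin (gamma lam).length)) :=
  {J | Admissible lam J ∧ BruhatLE (chainPerm lam J (gamma lam).length) w}

/-- The filling `T_J` of shape `λ` (zero outside `λ`): column `j` consists of the first `c_j` entries,
in increasing order, of the permutation reached after the segments `Γ(c_0), …, Γ(c_j)`. -/
def tableauOf (lam : DomPartition n) (J : Finset (Fin (gamma lam).length)) : Filling :=
  fun i j =>
    if (i, j) ∈ lam.diagram then
      sortedEntry (chainPerm lam J (gammaPrefix lam (j + 1)).length) (lam.col j) i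
    else 0

/-- `A_{λ,w}`, the set of all `T_J` with `J ∈ Ad(λ, w)`. -/
def alcoveTableaux (lam : DomPartition n) (w : Equiv.Perm (Fin n)) : Set Filling :=
  tableauOf lam '' Ad lam w

/-- `D_{λ,w}`, the set of `n`-semistandard tableaux `T` of shape `λ` with `R(T) ≤ Y_λ(w)`. -/
def demazureTableaux (lam : DomPartition n) (w : Equiv.Perm (Fin n)) : Set Filling :=
  {F | ∃ T : SemistandardYoungTableau lam.diagram, (T : Filling) = F ∧ HasLetters lam T ∧
    FillingLE lam (rightKey lam F) (keyOf lam w)}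

/-- The set of `n`-semistandard tableaux `T` of shape `λ` with `S(T) ≤ Y_λ(w)`. -/
def scanningTableaux (lam : DomPartition n) (w : Equiv.Perm (Fin n)) : Set Filling :=
  {F | ∃ T : SemistandardYoungTableau lam.diagram, (T : Filling) = F ∧ HasLetters lam T ∧
    FillingLE lam (scanningTableau lam F) (keyOf lam w)}

end Alcove

end Demazure

/-!
The theorem consists of two assertions: the right key of a semistandard tableau is its scanning
tableau, and the scanning tableau is at most `Y_λ(w)` exactly for the tableaux `T_J`.

*Right key and scanning.* Scanning all paths from a column `A` can be done column by column: passing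
a column `B` turns the list of last values `A` into `sweep A B` (`scanColumn_eq_foldl_sweep`). A
jeu de taquin exchange of two adjacent column lengths has the same effect on the right column
(`moveRight_eq_sweep`). This goes by induction on the part of `A` that lies below `B`: the lowest box
of `A` takes part only in the last slide, and that slide moves the same value as the sweep.

*Raising.* For a decreasing column `B`, a sweep amounts to letting every `b` in `B`, from the largest
down, replace the largest entry not exceeding `b` (`sweep_eq_foldl_raise`). For a list `L` let
`countGE L t` be the number of entries that are at least `t`, and for a permutation `u` let
`rank u d t` be the same number for the first `d` entries of `u`. These functions turn the entrywise
comparison of columns into a pointwise inequality. By the tableau criterion the Bruhat order is the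
pointwise order of the functions `rank` (`BruhatLE.rank_le`, `bruhatLE_of_rank_le`). Raising by `b`
makes `countGE` the least function that dominates the old one and counts `b` (`countGE_raise`).

*Each `T_J` belongs to the scanning set.* Along the chain of an admissible `J` the function `rank`
increases, so the columns of `T_J` form a semistandard tableau. By minimality of raising, the partial
scans from column `j` stay below the first `c_j` entries of the permutations in the chain, and
finally below those of `w` (`alcoveTableaux_subset`).

*Each tableau of the scanning set is some `T_J`.* Given `T`, a chain is built greedily: in the segment
`Γ(c_j)`, the entry at position `i` is exchanged with a later one whenever this moves it upwards but
not beyond `T(i, j)`. An entry that would prevent such an exchange from being a cover would have been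
taken up before, so the chain is saturated (`reach_climb`). Moreover the initial segments at and
beyond `c_j` change exactly by raising (`rank_climb`, `exists_reach_gammaRows`). Hence the last
permutation `u` has the columns of the scanning tableau as its initial segments of lengths `c_j`.
No ascent is lost except at column lengths, and this makes the inequalities at the `c_j` sufficient
for `u ≤ w` (`rank_le_of_rank_col_le`, `scanningTableaux_subset`).
-/

namespace Demazure

/-! ### Sweeping a column through the columns to its right -/

/-- The last values of all scanning paths after they have passed one further column `B`, when
their values so far are `A`; both are read from bottom to top, and the lower paths go first. -/
def sweep : List ℕ → List ℕ → List ℕ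
  | [], _ => []
  | a :: A, [] => a :: A
  | a :: A, b :: B => if a ≤ b then b :: sweep A B else a :: sweep A (b :: B)

/-- The values in `A` of those scanning paths which take up a value of the column `B`. -/
def matched : List ℕ → List ℕ → List ℕ
  | [], _ => []
  | _ :: _, [] => []
  | a :: A, b :: B => if a ≤ b then a :: matched A B else matched A (b :: B)

@[simp] theorem sweep_nil_right (A : List ℕ) : sweep A [] = A := by cases A <;> rfl

@[simp] theorem matched_nil_right (A : List ℕ) : matched A [] = [] := by cases A <;> rfl

theorem mem_of_mem_sweep {A B : List ℕ} {x : ℕ} (h : x ∈ sweep A B) : x ∈ A ∨ x ∈ B := by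
  induction A generalizing B with
  | nil => simp [sweep] at h
  | cons a A ih =>
    cases B with
    | nil => exact Or.inl h
    | cons b B =>
      simp only [sweep] at h
      split_ifs at h
      · rcases List.mem_cons.1 h with rfl | h
        · simp
        · rcases ih h with h | h <;> simp [h]
      · rcases List.mem_cons.1 h with rfl | h
        · simp
        · rcases ih h with h | h
          · simp [h]
          · exact Or.inr h

theorem pairwise_sweep {A B : List ℕ} (hA : A.Pairwise (· > ·)) (hB : B.Pairwise (· > ·)) :
    (sweep A B).Pairwise (· > ·) := by
  induction A generalizing B with
  | nil => simp [sweep]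
  | cons a A ih =>
    cases B with
    | nil => simpa using hA
    | cons b B =>
      have hA' := List.pairwise_cons.1 hA
      have hB' := List.pairwise_cons.1 hB
      simp only [sweep]
      split_ifs with hab
      · refine List.pairwise_cons.2 ⟨fun x hx => ?_, ih hA'.2 hB'.2⟩
        rcases mem_of_mem_sweep hx with h | h
        · exact lt_of_lt_of_le (hA'.1 x h) hab
        · exact hB'.1 x h
      · refine List.pairwise_cons.2 ⟨fun x hx => ?_, ih hA'.2 hB⟩
        rcases mem_of_mem_sweep hx with h | h
        · exact hA'.1 x h
        · rcases List.mem_cons.1 h with rfl | h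
          · exact not_le.1 hab
          · exact (hB'.1 x h).trans (not_le.1 hab)

/-- Scanning path by path amounts to sweeping column by column: whether a path takes up a value of
a column depends only on the lower paths, which precede it in either order. -/
theorem scanColumn_eq_foldl_sweep (A : List ℕ) (Cs : List (List ℕ)) :
    scanColumn A Cs = Cs.foldl sweep A := by
  have scan_cons : ∀ (A B : List ℕ) (Cs : List (List ℕ)),
      scanColumn A (B :: Cs) = scanColumn (sweep A B) Cs := by
    intro A
    induction A with
    | nil => intro B Cs; rfl
    | cons a A ih =>
      intro B Cs
      cases B with
      | nil => simp [scanColumn, scanFrom, ih]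
      | cons b B =>
        by_cases hab : a ≤ b <;> simp [scanColumn, scanFrom, sweep, hab, ih]
  induction Cs generalizing A with
  | nil =>
    induction A with
    | nil => rfl
    | cons a A ih => simpa [scanColumn, scanFrom] using ih
  | cons B Cs ih => rw [scan_cons, ih, List.foldl_cons]

/-! ### Jeu de taquin on two columns -/

/-- `A` and `B`, read from bottom to top, are two top-justified columns, of which the left one `A`
is at least as long as `B`, with weakly increasing rows. -/
inductive TopLE : List ℕ → List ℕ → Prop
  | rows {A B : List ℕ} : List.Forall₂ (· ≤ ·) A B → TopLE A B
  | extend {A B : List ℕ} (a : ℕ) : TopLE A B → TopLE (a :: A) B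

namespace TopLE

theorem length_le {A B : List ℕ} (h : TopLE A B) : B.length ≤ A.length := by
  induction h with
  | rows h => exact h.length_eq.ge
  | extend a _ ih => exact ih.trans (by simp)

theorem drop_right {A B : List ℕ} {b : ℕ} (h : TopLE A (b :: B)) : TopLE A B := by
  generalize hB : b :: B = B' at h
  induction h with
  | rows h =>
    subst hB
    cases h with
    | cons _ h => exact extend _ (rows h)
  | extend a _ ih => exact extend a (ih hB)

theorem tail {A B : List ℕ} {a b : ℕ} (h : TopLE (a :: A) (b :: B)) : TopLE A B := by
  cases h with
  | rows h => cases h with | cons _ h => exact rows h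
  | extend _ h => exact h.drop_right

theorem trans {A B C : List ℕ} (h : TopLE A B) (h' : TopLE B C) : TopLE A C := by
  induction h with
  | rows h =>
    rename_i A B
    induction h' generalizing A with
    | rows h' =>
      rename_i B C
      refine rows ?_
      induction h' generalizing A with
      | nil => exact h
      | cons hbc _ ih =>
        cases h with
        | cons hab h => exact .cons (hab.trans hbc) (ih h)
    | extend b _ ih =>
      cases h with
      | cons _ h => exact extend _ (ih h)
  | extend a _ ih => exact extend a (ih h')

theorem cons_cons {A B : List ℕ} {a b : ℕ} (h : TopLE A B) (hA : ∀ x ∈ A, x ≤ b) (hab : a ≤ b) :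
    TopLE (a :: A) (b :: B) := by
  induction h generalizing a with
  | rows h => exact rows (.cons hab h)
  | extend c _ ih =>
    exact extend a (ih (fun x hx => hA x (List.mem_cons_of_mem _ hx)) (hA c (by simp)))

theorem of_sublist {A B : List ℕ} (hA : A.Pairwise (· > ·)) (h : B.Sublist A) : TopLE A B := by
  induction h with
  | slnil => exact rows .nil
  | cons a _ ih => exact extend a (ih (List.pairwise_cons.1 hA).2)
  | cons_cons a _ ih =>
    have hA' := List.pairwise_cons.1 hA
    exact (ih hA'.2).cons_cons (fun x hx => (hA'.1 x hx).le) le_rfl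

end TopLE

/-- All values of the column `B` are taken up by the paths that come from a longer column. -/
theorem sublist_sweep {A B : List ℕ} (h : TopLE A B) : B.Sublist (sweep A B) := by
  induction A generalizing B with
  | nil =>
    have := h.length_le
    simp_all
  | cons a A ih =>
    cases B with
    | nil => simp
    | cons b B =>
      simp only [sweep]
      split_ifs with hab
      · exact (ih h.tail).cons_cons b
      · refine (ih ?_).cons a
        cases h with
        | rows h => cases h with | cons h _ => exact absurd h hab
        | extend _ h => exact h

/-- The lowest box of the left column takes part only in the last slide. -/
theorem slides_succ_cons (d p : ℕ) (A B : List ℕ) :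
    slides (d + 1) (p :: A) B = slide (p :: (slides d A B).1) (slides d A B).2 := by
  induction d generalizing A B with
  | zero => simp [slides]
  | succ d ih =>
    rw [slides, List.take_succ_cons, List.drop_succ_cons, List.cons_append, ih]
    rfl

/-- Adding a box `p` at the bottom of the left column and performing one more slide moves the same
value to the right as the sweep does. -/
theorem slide_matched_sweep {p : ℕ} {A B : List ℕ} (hA : (p :: A).Pairwise (· > ·))
    (hBA : B.length ≤ A.length) :
    slide (p :: matched A B) (sweep A B) = (matched (p :: A) B, sweep (p :: A) B) := by
  induction A generalizing p B with
  | nil =>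
    obtain rfl : B = [] := by simpa using hBA
    rfl
  | cons a A ih =>
    have hA' := List.pairwise_cons.1 hA
    have hap : a < p := hA'.1 a (by simp)
    cases B with
    | nil => simp [slide, hap]
    | cons b B =>
      by_cases hpb : p ≤ b
      · have hab : a ≤ b := hap.le.trans hpb
        have h := ih (p := a) (B := B) hA'.2 (by simpa using hBA)
        rw [matched, sweep, if_pos hab, if_pos hab, slide, if_neg (not_lt.2 hpb), h]
        conv_rhs => rw [matched, sweep, if_pos hpb, if_pos hpb]
      · conv_rhs => rw [matched, sweep, if_neg hpb, if_neg hpb]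
        have : ∃ x X, sweep (a :: A) (b :: B) = x :: X ∧ x < p := by
          rw [sweep]
          split_ifs
          · exact ⟨_, _, rfl, not_le.1 hpb⟩
          · exact ⟨_, _, rfl, hap⟩
        obtain ⟨x, X, hX, hx⟩ := this
        rw [hX, slide, if_pos hx]

theorem matched_sweep_of_forall₂ {A B : List ℕ} (h : List.Forall₂ (· ≤ ·) A B) :
    matched A B = A ∧ sweep A B = B := by
  induction h with
  | nil => exact ⟨rfl, rfl⟩
  | cons hab _ ih => simp [matched, sweep, hab, ih.1, ih.2]

/-- Exchanging two column lengths by jeu de taquin leaves the matched values in the left column. -/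
theorem slides_eq {A B : List ℕ} (hA : A.Pairwise (· > ·)) (h : TopLE A B) :
    slides (A.length - B.length) A B = (matched A B, sweep A B) := by
  induction h with
  | rows h =>
    rw [h.length_eq, Nat.sub_self, slides, (matched_sweep_of_forall₂ h).1,
      (matched_sweep_of_forall₂ h).2]
  | extend a h ih =>
    rw [List.length_cons, Nat.sub_add_comm h.length_le, slides_succ_cons,
      ih (List.pairwise_cons.1 hA).2]
    exact slide_matched_sweep hA h.length_le

theorem moveRight_eq_sweep {A B : List ℕ} (hA : A.Pairwise (· > ·)) (h : TopLE A B) :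
    moveRight A B = sweep A B := by
  rw [moveRight, slides_eq hA h]

theorem foldl_moveRight_eq_foldl_sweep {A : List ℕ} {Bs : List (List ℕ)}
    (hA : A.Pairwise (· > ·)) (hBs : ∀ B ∈ Bs, B.Pairwise (· > ·))
    (h : (A :: Bs).Pairwise TopLE) : Bs.foldl moveRight A = Bs.foldl sweep A := by
  induction Bs generalizing A with
  | nil => rfl
  | cons B Bs ih =>
    rw [List.pairwise_cons] at h
    have hAB := h.1 B (by simp)
    have hB := hBs B (by simp)
    rw [List.foldl_cons, List.foldl_cons, moveRight_eq_sweep hA hAB]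
    refine ih (pairwise_sweep hA hB) (fun C hC => hBs C (by simp [hC])) ?_
    rw [List.pairwise_cons] at h ⊢
    exact ⟨fun C hC => (TopLE.of_sublist (pairwise_sweep hA hB) (sublist_sweep hAB)).trans
      (h.2.1 C hC), h.2.2⟩

/-! ### Raising a decreasing list -/

/-- The number of entries of `L` that are at least `t`. -/
def countGE (L : List ℕ) (t : ℕ) : ℕ := L.countP (t ≤ ·)

theorem countGE_cons (a : ℕ) (L : List ℕ) (t : ℕ) :
    countGE (a :: L) t = countGE L t + if t ≤ a then 1 else 0 := by
  simp [countGE, List.countP_cons]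

theorem countGE_le_length (L : List ℕ) (t : ℕ) : countGE L t ≤ L.length := List.countP_le_length

theorem countGE_eq_zero {L : List ℕ} {t : ℕ} (h : ∀ x ∈ L, x < t) : countGE L t = 0 := by
  simpa [countGE, List.countP_eq_zero] using h

theorem getD_lt_iff {L : List ℕ} (hL : L.Pairwise (· > ·)) {k : ℕ} (hk : k < L.length) (t : ℕ) :
    L.getD k 0 < t ↔ countGE L t ≤ k := by
  induction L generalizing k with
  | nil => simp at hk
  | cons a L ih =>
    have hL' := List.pairwise_cons.1 hL
    rw [countGE_cons]
    rcases Nat.lt_or_ge a t with h | h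
    · have h0 : countGE L t = 0 := countGE_eq_zero fun x hx => (hL'.1 x hx).trans h
      rw [h0, if_neg (not_le.2 h)]
      simp only [add_zero, zero_le, iff_true]
      cases k with
      | zero => simpa using h
      | succ k =>
        have hk' : k < L.length := by simpa using hk
        have := (ih hL'.2 hk').2 (by simp [h0])
        simpa using this
    · rw [if_pos h]
      cases k with
      | zero => simpa using h
      | succ k =>
        have hk' : k < L.length := by simpa using hk
        simpa using ih hL'.2 hk'

/-- Replace the first entry of `L` that is at most `b` by `b`. -/
def raise : List ℕ → ℕ → List ℕ
  | [], _ => []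
  | a :: A, b => if a ≤ b then b :: A else a :: raise A b

@[simp] theorem length_raise (L : List ℕ) (b : ℕ) : (raise L b).length = L.length := by
  induction L with
  | nil => rfl
  | cons a A ih => rw [raise]; split_ifs <;> simp [ih]

theorem mem_of_mem_raise {L : List ℕ} {b x : ℕ} (h : x ∈ raise L b) : x ∈ L ∨ x = b := by
  induction L with
  | nil => simp [raise] at h
  | cons a A ih =>
    rw [raise] at h
    split_ifs at h
    · rcases List.mem_cons.1 h with h | h <;> simp [h]
    · rcases List.mem_cons.1 h with h | h
      · simp [h]
      · rcases ih h with h | h <;> simp [h]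

theorem pairwise_raise {L : List ℕ} (hL : L.Pairwise (· > ·)) (b : ℕ) :
    (raise L b).Pairwise (· > ·) := by
  induction L with
  | nil => simp [raise]
  | cons a A ih =>
    have hL' := List.pairwise_cons.1 hL
    rw [raise]
    split_ifs with hab
    · exact List.pairwise_cons.2 ⟨fun x hx => lt_of_lt_of_le (hL'.1 x hx) hab, hL'.2⟩
    · refine List.pairwise_cons.2 ⟨fun x hx => ?_, ih hL'.2⟩
      rcases mem_of_mem_raise hx with h | rfl
      · exact hL'.1 x h
      · exact not_le.1 hab

theorem length_foldl_raise (L B : List ℕ) : (B.foldl raise L).length = L.length := by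
  induction B generalizing L with
  | nil => rfl
  | cons b B ih => rw [List.foldl_cons, ih, length_raise]

theorem pairwise_foldl_raise {L : List ℕ} (hL : L.Pairwise (· > ·)) (B : List ℕ) :
    (B.foldl raise L).Pairwise (· > ·) := by
  induction B generalizing L with
  | nil => exact hL
  | cons b B ih => exact ih (pairwise_raise hL b)

theorem foldl_raise_cons {a : ℕ} (A : List ℕ) {B : List ℕ} (h : ∀ b ∈ B, b < a) :
    B.foldl raise (a :: A) = a :: B.foldl raise A := by
  induction B generalizing A with
  | nil => rfl
  | cons b B ih =>
    rw [List.foldl_cons, List.foldl_cons, raise, if_neg (not_le.2 (h b (by simp)))]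
    exact ih _ fun c hc => h c (by simp [hc])

/-- A sweep handles the values of the column one after the other, each replacing the largest value
that does not exceed it. -/
theorem sweep_eq_foldl_raise (A : List ℕ) {B : List ℕ} (hB : B.Pairwise (· > ·)) :
    sweep A B = B.foldl raise A := by
  induction A generalizing B with
  | nil =>
    rw [sweep]
    clear hB
    induction B with
    | nil => rfl
    | cons b B ih => exact ih
  | cons a A ih =>
    cases B with
    | nil => rfl
    | cons b B =>
      have hB' := List.pairwise_cons.1 hB
      rw [sweep]
      split_ifs with hab
      · rw [List.foldl_cons, raise, if_pos hab, foldl_raise_cons A hB'.1, ih hB'.2]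
      · rw [ih hB, foldl_raise_cons A]
        intro c hc
        rcases List.mem_cons.1 hc with rfl | hc
        · exact not_le.1 hab
        · exact (hB'.1 c hc).trans (not_le.1 hab)

theorem countGE_raise_of_lt {L : List ℕ} {b t : ℕ} (h : b < t) :
    countGE (raise L b) t = countGE L t := by
  induction L with
  | nil => rfl
  | cons a A ih =>
    rw [raise]
    split_ifs with hab
    · rw [countGE_cons, countGE_cons, if_neg (by omega), if_neg (by omega)]
    · rw [countGE_cons, countGE_cons, ih]

/-- If some entry of `L` is at most `b`, then raising it to `b` increases the counting function to
the least one that counts `b`. -/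
theorem countGE_raise {L : List ℕ} (hL : L.Pairwise (· > ·)) {b t : ℕ} (h : t ≤ b)
    (hb : countGE L (b + 1) < L.length) :
    countGE (raise L b) t = max (countGE L t) (countGE L (b + 1) + 1) := by
  induction L with
  | nil => simp at hb
  | cons a A ih =>
    have hL' := List.pairwise_cons.1 hL
    rw [raise]
    split_ifs with hab
    · have h0 : countGE A (b + 1) = 0 :=
        countGE_eq_zero fun x hx => ((hL'.1 x hx).le.trans hab).trans_lt b.lt_succ_self
      rw [countGE_cons, countGE_cons, countGE_cons, h0, if_pos h,
        if_neg (show ¬b + 1 ≤ a by omega)]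
      split_ifs with hta
      · omega
      · have : countGE A t = 0 := countGE_eq_zero fun x hx =>
          (hL'.1 x hx).trans (not_le.1 hta)
        omega
    · have hlt : countGE A (b + 1) < A.length := by
        rw [countGE_cons, if_pos (by omega)] at hb
        simpa using hb
      rw [countGE_cons, countGE_cons, countGE_cons, ih hL'.2 hlt, if_pos (by omega),
        if_pos (by omega)]
      omega

theorem countGE_raise_le {L : List ℕ} (hL : L.Pairwise (· > ·)) {b t : ℕ} (h : t ≤ b) :
    countGE (raise L b) t ≤ max (countGE L t) (countGE L (b + 1) + 1) := by
  rcases (countGE_le_length L (b + 1)).lt_or_eq with hb | hb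
  · exact (countGE_raise hL h hb).le
  · have := countGE_le_length (raise L b) t
    rw [length_raise] at this
    omega

variable {n : ℕ}

/-! ### Inversions and covers -/

theorem val_swap (a b x : Fin n) :
    ((Equiv.swap a b x : Fin n) : ℕ) = if (x : ℕ) = a then (b : ℕ) else
      if (x : ℕ) = b then (a : ℕ) else x := by
  simp only [Equiv.swap_apply_def, Fin.ext_iff]
  split_ifs <;> rfl

/-- The involution on pairs of positions that matches the inversions before and after `a` and `b`
are interchanged. -/
def swapPair (a b : Fin n) (p : Fin n × Fin n) : Fin n × Fin n :=
  if Equiv.swap a b p.1 < Equiv.swap a b p.2 then (Equiv.swap a b p.1, Equiv.swap a b p.2) else p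

theorem swapPair_swapPair (a b : Fin n) {p : Fin n × Fin n} (hp : p.1 < p.2) :
    swapPair a b (swapPair a b p) = p := by
  by_cases h : Equiv.swap a b p.1 < Equiv.swap a b p.2
  · rw [swapPair, swapPair, if_pos h]
    simp [hp]
  · simp [swapPair, h]

theorem apply_swapPair (u : Equiv.Perm (Fin n)) {a b : Fin n} (hab : a < b) (h : u a < u b)
    {p : Fin n × Fin n} (hp : p.1 < p.2 ∧ u p.2 < u p.1) :
    (swapPair a b p).1 < (swapPair a b p).2 ∧
      (u * Equiv.swap a b) (swapPair a b p).2 < (u * Equiv.swap a b) (swapPair a b p).1 ∧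
      swapPair a b p ≠ (a, b) := by
  obtain ⟨p, q⟩ := p
  obtain ⟨hpq, hu⟩ := hp
  dsimp only at hpq hu
  by_cases hs : Equiv.swap a b p < Equiv.swap a b q
  · simp only [swapPair, hs, if_true, Equiv.Perm.mul_apply, Equiv.swap_apply_self, true_and]
    refine ⟨hu, fun he => ?_⟩
    have h1 := congrArg (fun x => (Equiv.swap a b x.1 : Fin n)) he
    have h2 := congrArg (fun x => (Equiv.swap a b x.2 : Fin n)) he
    simp only [Equiv.swap_apply_self, Equiv.swap_apply_left, Equiv.swap_apply_right] at h1 h2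
    subst h1 h2
    exact absurd hab hpq.asymm
  · simp only [swapPair, hs, if_false, Equiv.Perm.mul_apply]
    refine ⟨hpq, ?_, ?_⟩
    · rw [Equiv.swap_apply_def, Equiv.swap_apply_def]
      rw [Fin.lt_def, val_swap, val_swap] at hs
      rw [Fin.lt_def] at hpq hab
      rcases eq_or_ne p a with rfl | hpa
      · rcases eq_or_ne q b with rfl | hqb
        · exact absurd h hu.asymm
        · have hqp : q ≠ p := fun he => by simp [he] at hpq
          simpa [hqb, hqp] using hu.trans h
      · rcases eq_or_ne q b with rfl | hqb
        · have hqp : p ≠ q := fun he => by simp [he] at hpq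
          have hqa : q ≠ a := fun he => by simp [he] at hab
          simpa [hqa, hpa, hqp] using h.trans hu
        · exfalso
          rw [Ne, Fin.ext_iff] at hpa hqb
          split_ifs at hs <;> omega
    · rintro he
      rw [Prod.mk.injEq] at he
      obtain ⟨rfl, rfl⟩ := he
      exact absurd h hu.asymm

theorem apply_swapPair_of_cover (u : Equiv.Perm (Fin n)) {a b : Fin n} (hab : a < b)
    (h : u a < u b) (hno : ∀ k, a < k → k < b → u k < u a ∨ u b < u k)
    {p : Fin n × Fin n} (hp : p.1 < p.2)
    (hv : (u * Equiv.swap a b) p.2 < (u * Equiv.swap a b) p.1) (hne : p ≠ (a, b)) :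
    (swapPair a b p).1 < (swapPair a b p).2 ∧ u (swapPair a b p).2 < u (swapPair a b p).1 := by
  obtain ⟨p, q⟩ := p
  dsimp only at hp hv
  by_cases hs : Equiv.swap a b p < Equiv.swap a b q
  · simp only [swapPair, hs, if_true, true_and]
    exact hv
  · simp only [swapPair, hs, if_false]
    refine ⟨hp, ?_⟩
    rw [Equiv.Perm.mul_apply, Equiv.Perm.mul_apply, Equiv.swap_apply_def, Equiv.swap_apply_def] at hv
    rw [Fin.lt_def, val_swap, val_swap] at hs
    rw [Fin.lt_def] at hp hab
    rcases eq_or_ne p a with rfl | hpa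
    · rcases eq_or_ne q b with rfl | hqb
      · exact absurd rfl hne
      · have hqp : q ≠ p := fun he => by simp [he] at hp
        have hqb' : (q : ℕ) < b := by
          rw [Ne, Fin.ext_iff] at hqb hqp
          split_ifs at hs <;> omega
        simp [hqb, hqp] at hv
        exact (hno q hp hqb').resolve_right hv.asymm
    · rcases eq_or_ne q b with rfl | hqb
      · have hqp : p ≠ q := fun he => by simp [he] at hp
        have hqa : q ≠ a := fun he => by simp [he] at hab
        have hap : (a : ℕ) < p := by
          rw [Ne, Fin.ext_iff] at hpa hqa
          split_ifs at hs <;> omega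
        simp [hqa, hpa, hqp] at hv
        exact (hno p hap hp).resolve_left hv.asymm
      · exfalso
        rw [Ne, Fin.ext_iff] at hpa hqb
        split_ifs at hs <;> omega

theorem inversions_lt_of_swap (u : Equiv.Perm (Fin n)) {a b : Fin n} (hab : a < b)
    (h : u a < u b) : inversions u < inversions (u * Equiv.swap a b) := by
  have hmem : (a, b) ∈ Finset.univ.filter fun p : Fin n × Fin n =>
      p.1 < p.2 ∧ (u * Equiv.swap a b) p.2 < (u * Equiv.swap a b) p.1 :=
    Finset.mem_filter.2 ⟨Finset.mem_univ _, hab, by simpa using h⟩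
  refine Nat.lt_of_le_of_lt ?_ (Finset.card_erase_lt_of_mem hmem)
  refine Finset.card_le_card_of_injOn (swapPair a b) (fun p hp => ?_) fun p hp q hq he => ?_
  · have hp' : p.1 < p.2 ∧ u p.2 < u p.1 := by simpa using hp
    have := apply_swapPair u hab h hp'
    simp only [Finset.coe_erase, Set.mem_sdiff, Finset.coe_filter, Set.mem_ofPred_eq,
      Set.mem_singleton_iff]
    exact ⟨⟨Finset.mem_univ _, this.1, this.2.1⟩, this.2.2⟩
  · have hp' : p.1 < p.2 ∧ u p.2 < u p.1 := by simpa using hp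
    have hq' : q.1 < q.2 ∧ u q.2 < u q.1 := by simpa using hq
    rw [← swapPair_swapPair a b hp'.1, he, swapPair_swapPair a b hq'.1]

/-- If no entry between positions `a` and `b` has a value between `u a < u b`, then interchanging the
two creates exactly one inversion: apart from the new inversion `(a, b)`, the inversions before and
after correspond under `swapPair`. -/
theorem bruhatCover_swap (u : Equiv.Perm (Fin n)) {a b : Fin n} (hab : a < b)
    (h : u a < u b) (hno : ∀ k, a < k → k < b → u k < u a ∨ u b < u k) :
    BruhatCover u (u * Equiv.swap a b) := by
  refine ⟨⟨a, b, rfl⟩, le_antisymm ?_ (inversions_lt_of_swap u hab h)⟩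
  have hmem : (a, b) ∈ Finset.univ.filter fun p : Fin n × Fin n =>
      p.1 < p.2 ∧ (u * Equiv.swap a b) p.2 < (u * Equiv.swap a b) p.1 :=
    Finset.mem_filter.2 ⟨Finset.mem_univ _, hab, by simpa using h⟩
  unfold inversions
  rw [← Finset.card_erase_add_one hmem, Nat.add_le_add_iff_right]
  have key : ∀ p : Fin n × Fin n, p ∈ ((Finset.univ.filter fun p : Fin n × Fin n =>
      p.1 < p.2 ∧ (u * Equiv.swap a b) p.2 < (u * Equiv.swap a b) p.1).erase (a, b) : Finset _) →
      p.1 < p.2 ∧ (u * Equiv.swap a b) p.2 < (u * Equiv.swap a b) p.1 ∧ p ≠ (a, b) := by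
    intro p hp
    rw [Finset.mem_erase, Finset.mem_filter] at hp
    exact ⟨hp.2.2.1, hp.2.2.2, hp.1⟩
  refine Finset.card_le_card_of_injOn (swapPair a b) (fun p hp => ?_) fun p hp q hq he => ?_
  · obtain ⟨h1, h2, h3⟩ := key p hp
    have := apply_swapPair_of_cover u hab h hno h1 h2 h3
    simp only [Finset.coe_filter, Set.mem_ofPred_eq]
    exact ⟨Finset.mem_univ _, this.1, this.2⟩
  · rw [← swapPair_swapPair a b (key p hp).1, he, swapPair_swapPair a b (key q hq).1]

/-! ### Counting large entries in initial segments -/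

/-- The number of the first `d` entries of the one-rowed form of `u` that are at least `t`. -/
def rank (u : Equiv.Perm (Fin n)) (d t : ℕ) : ℕ :=
  (Finset.univ.filter fun k : Fin n => (k : ℕ) < d ∧ t ≤ (u k : ℕ) + 1).card

theorem rank_zero (u : Equiv.Perm (Fin n)) (t : ℕ) : rank u 0 t = 0 := by simp [rank]

theorem rank_succ (u : Equiv.Perm (Fin n)) (k : Fin n) (t : ℕ) :
    rank u ((k : ℕ) + 1) t = rank u k t + if t ≤ (u k : ℕ) + 1 then 1 else 0 := by
  unfold rank
  have : (Finset.univ.filter fun j : Fin n => (j : ℕ) < (k : ℕ) + 1 ∧ t ≤ (u j : ℕ) + 1) =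
      (Finset.univ.filter fun j : Fin n => (j : ℕ) < (k : ℕ) ∧ t ≤ (u j : ℕ) + 1) ∪
      (if t ≤ (u k : ℕ) + 1 then {k} else ∅) := by
    ext j
    simp only [Finset.mem_filter, Finset.mem_univ, true_and, Finset.mem_union]
    by_cases hj : j = k
    · subst hj
      split_ifs <;> simp_all
    · have : (j : ℕ) ≠ k := fun h => hj (Fin.ext h)
      have h2 : j ∉ (if t ≤ (u k : ℕ) + 1 then {k} else ∅ : Finset (Fin n)) := by
        split_ifs <;> simp [hj]
      simp only [h2, or_false]
      constructor <;> rintro ⟨_, _⟩ <;> refine ⟨by omega, by omega⟩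
  rw [this, Finset.card_union_of_disjoint]
  · split_ifs <;> simp
  · split_ifs <;> simp

theorem rank_le (u : Equiv.Perm (Fin n)) {d : ℕ} (hd : d ≤ n) (t : ℕ) : rank u d t ≤ d := by
  induction d with
  | zero => rw [rank_zero]
  | succ d ih =>
    have := rank_succ u ⟨d, hd⟩ t
    have := ih (by omega)
    simp only at *
    split_ifs at * <;> omega

theorem rank_mono (u : Equiv.Perm (Fin n)) {d e : ℕ} (h : d ≤ e) (t : ℕ) :
    rank u d t ≤ rank u e t :=
  Finset.card_le_card fun k hk => by
    simp only [Finset.mem_filter, Finset.mem_univ, true_and] at hk ⊢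
    exact ⟨by omega, hk.2⟩

theorem rank_lt (u : Equiv.Perm (Fin n)) {i : Fin n} {d s t : ℕ} (hi : (i : ℕ) < d)
    (hs : s ≤ (u i : ℕ) + 1) (ht : (u i : ℕ) + 1 < t) : rank u d t < rank u d s := by
  refine Finset.card_lt_card ((Finset.ssubset_iff_of_subset fun k hk => ?_).2 ⟨i, ?_, ?_⟩)
  · rw [Finset.mem_filter] at hk ⊢
    exact ⟨hk.1, hk.2.1, by omega⟩
  · rw [Finset.mem_filter]
    exact ⟨Finset.mem_univ _, hi, hs⟩
  · rw [Finset.mem_filter]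
    omega

theorem rank_le_add (u : Equiv.Perm (Fin n)) {d e : ℕ} (h : d ≤ e) (he : e ≤ n) (t : ℕ) :
    rank u e t ≤ rank u d t + (e - d) := by
  induction e, h using Nat.le_induction with
  | base => simp
  | succ e hde ih =>
    have := rank_succ u ⟨e, he⟩ t
    have := ih (by omega)
    simp only at *
    split_ifs at * <;> omega

theorem rank_top (u v : Equiv.Perm (Fin n)) (t : ℕ) : rank u n t = rank v n t := by
  refine Finset.card_bij' (fun k _ => v⁻¹ (u k)) (fun k _ => u⁻¹ (v k)) ?_ ?_ ?_ ?_ <;> simp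

/-- If the first `d` entries of `u` and `v` agree except at position `i`, their counts differ only
by the contribution of that position. -/
theorem rank_update {u v : Equiv.Perm (Fin n)} {d : ℕ} {i : Fin n} (hi : (i : ℕ) < d)
    (h : ∀ k : Fin n, (k : ℕ) < d → k ≠ i → v k = u k) (t : ℕ) :
    rank v d t + (if t ≤ (u i : ℕ) + 1 then 1 else 0) =
      rank u d t + if t ≤ (v i : ℕ) + 1 then 1 else 0 := by
  have key : ∀ x : Equiv.Perm (Fin n), rank x d t =
      ((Finset.univ.erase i).filter fun k : Fin n => (k : ℕ) < d ∧ t ≤ (x k : ℕ) + 1).card +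
        if t ≤ (x i : ℕ) + 1 then 1 else 0 := by
    intro x
    rw [rank, Finset.filter_erase]
    split_ifs with hx
    · rw [Finset.card_erase_add_one]
      simp [hi, hx]
    · rw [Finset.erase_eq_of_notMem, add_zero]
      simp [hx]
  rw [key u, key v]
  have : ((Finset.univ.erase i).filter fun k : Fin n => (k : ℕ) < d ∧ t ≤ (v k : ℕ) + 1) =
      (Finset.univ.erase i).filter fun k : Fin n => (k : ℕ) < d ∧ t ≤ (u k : ℕ) + 1 := by
    refine Finset.filter_congr fun k hk => ?_
    refine and_congr_right fun hkd => ?_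
    rw [h k hkd (Finset.ne_of_mem_erase hk)]
  rw [this]
  omega

theorem rank_swap_of_lt (u : Equiv.Perm (Fin n)) {a b : Fin n} {d : ℕ} (ha : (a : ℕ) < d)
    (hb : (b : ℕ) < d) (t : ℕ) : rank (u * Equiv.swap a b) d t = rank u d t := by
  unfold rank
  have hs : ∀ k : Fin n, ((Equiv.swap a b k : Fin n) : ℕ) < d ↔ (k : ℕ) < d := fun k => by
    rw [val_swap]; split_ifs <;> omega
  refine Finset.card_bij' (fun k _ => Equiv.swap a b k) (fun k _ => Equiv.swap a b k) ?_ ?_ ?_ ?_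
  · intro k hk
    rw [Finset.mem_filter] at hk ⊢
    exact ⟨Finset.mem_univ _, (hs k).2 hk.2.1, hk.2.2⟩
  · intro k hk
    rw [Finset.mem_filter] at hk ⊢
    refine ⟨Finset.mem_univ _, (hs k).2 hk.2.1, ?_⟩
    simpa using hk.2.2
  · simp
  · simp

theorem rank_swap_of_le (u : Equiv.Perm (Fin n)) {a b : Fin n} {d : ℕ} (ha : (a : ℕ) < d)
    (hb : d ≤ (b : ℕ)) (t : ℕ) :
    rank (u * Equiv.swap a b) d t + (if t ≤ (u a : ℕ) + 1 then 1 else 0) =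
      rank u d t + if t ≤ (u b : ℕ) + 1 then 1 else 0 := by
  have := rank_update (u := u) (v := u * Equiv.swap a b) ha (fun k hk hka => ?_) t
  · simpa using this
  · have : k ≠ b := by rintro rfl; omega
    simp [Equiv.swap_apply_of_ne_of_ne hka this]

theorem rank_swap_of_le_left (u : Equiv.Perm (Fin n)) {a b : Fin n} {d : ℕ} (ha : d ≤ (a : ℕ))
    (hb : d ≤ (b : ℕ)) (t : ℕ) : rank (u * Equiv.swap a b) d t = rank u d t := by
  unfold rank
  congr 1
  refine Finset.filter_congr fun k _ => and_congr_right fun hk => ?_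
  have hka : k ≠ a := by rintro rfl; omega
  have hkb : k ≠ b := by rintro rfl; omega
  simp [Equiv.swap_apply_of_ne_of_ne hka hkb]

/-! ### The tableau criterion for the Bruhat order -/

theorem BruhatCover.exists_lt {u v : Equiv.Perm (Fin n)} (h : BruhatCover u v) :
    ∃ a b : Fin n, a < b ∧ u a < u b ∧ v = u * Equiv.swap a b := by
  obtain ⟨⟨a, b, rfl⟩, hinv⟩ := h
  -- The entries increase from `a` to `b`, since otherwise the interchange removes inversions.
  have key : ∀ a b : Fin n, a < b → inversions (u * Equiv.swap a b) = inversions u + 1 →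
      u a < u b := by
    intro a b hab hinv
    by_contra hlt
    have hne : u a ≠ u b := fun he => hab.ne (u.injective he)
    have := inversions_lt_of_swap (u * Equiv.swap a b) hab
      (by simpa using lt_of_le_of_ne (not_lt.1 hlt) hne.symm)
    rw [mul_assoc, Equiv.swap_mul_self, mul_one] at this
    omega
  rcases lt_trichotomy a b with hab | rfl | hab
  · exact ⟨a, b, hab, key a b hab hinv, rfl⟩
  · rw [Equiv.swap_self] at hinv
    exact absurd hinv (Nat.succ_ne_self _).symm
  · rw [Equiv.swap_comm] at hinv
    exact ⟨b, a, hab, key b a hab hinv, by rw [Equiv.swap_comm]⟩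

theorem BruhatCover.rank_le {u v : Equiv.Perm (Fin n)} (h : BruhatCover u v) (d t : ℕ) :
    rank u d t ≤ rank v d t := by
  obtain ⟨a, b, hab, hu, rfl⟩ := h.exists_lt
  rw [Fin.lt_def] at hab hu
  rcases Nat.lt_or_ge a d with ha | ha
  · rcases Nat.lt_or_ge b d with hb | hb
    · exact (rank_swap_of_lt u ha hb t).ge
    · have := rank_swap_of_le u ha hb t
      split_ifs at this <;> omega
  · exact (rank_swap_of_le_left u ha (by omega) t).ge

theorem BruhatLE.rank_le {u v : Equiv.Perm (Fin n)} (h : BruhatLE u v) (d t : ℕ) :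
    rank u d t ≤ rank v d t := by
  induction h with
  | refl => exact le_rfl
  | tail _ h ih => exact ih.trans (h.rank_le d t)

theorem inversions_le (u : Equiv.Perm (Fin n)) : inversions u ≤ n * n := by
  refine (Finset.card_le_univ _).trans ?_
  simp

/-- One step up from `u` towards `v`: at the first position `a` where they differ, bring in the
next entry of `u` that lies between `u a` and `v a`. -/
theorem exists_bruhatCover_of_rank_le {u v : Equiv.Perm (Fin n)} (hne : u ≠ v)
    (h : ∀ d t, rank u d t ≤ rank v d t) :
    ∃ u', BruhatCover u u' ∧ ∀ d t, rank u' d t ≤ rank v d t := by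
  have hex : ∃ a : Fin n, u a ≠ v a := by
    by_contra hcon
    push Not at hcon
    exact hne (Equiv.ext hcon)
  obtain ⟨a, ha, hamin⟩ := exists_minimal_of_wellFoundedLT (fun a : Fin n => u a ≠ v a) hex
  replace hamin : ∀ k < a, u k = v k := fun k hk => by
    by_contra hcon
    exact absurd (hamin hcon hk.le) (not_le.2 hk)
  have hrank : ∀ t, rank u a t = rank v a t := fun t => by
    unfold rank
    congr 1
    refine Finset.filter_congr fun k _ => and_congr_right fun hk => ?_
    rw [hamin k hk]
  have hlt : u a < v a := by
    have h1 := h ((a : ℕ) + 1) ((u a : ℕ) + 1)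
    rw [rank_succ, rank_succ, hrank, if_pos le_rfl] at h1
    split_ifs at h1 with h2
    · exact lt_of_le_of_ne (Fin.le_def.2 (by omega)) ha
    · omega
  have hex' : ∃ b : Fin n, a < b ∧ u a < u b ∧ u b ≤ v a := by
    refine ⟨u⁻¹ (v a), ?_, by simpa using hlt, by simp⟩
    by_contra hcon
    rcases (not_lt.1 hcon).lt_or_eq with h1 | h1
    · have := hamin _ h1
      exact h1.ne (v.injective (by simpa using this.symm))
    · apply ha
      conv_lhs => rw [← h1]
      simp
  obtain ⟨b, ⟨hab, hub, hbv⟩, hbmin⟩ := exists_minimal_of_wellFoundedLT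
    (fun b : Fin n => a < b ∧ u a < u b ∧ u b ≤ v a) hex'
  have hno : ∀ k, a < k → k < b → u k < u a ∨ v a < u k := by
    intro k hak hkb
    by_contra hcon
    push Not at hcon
    have hne' : u a ≠ u k := fun he => hak.ne (u.injective he)
    exact absurd (hbmin ⟨hak, lt_of_le_of_ne hcon.1 hne', hcon.2⟩ hkb.le) (not_le.2 hkb)
  refine ⟨u * Equiv.swap a b, bruhatCover_swap u hab hub fun k h1 h2 =>
    (hno k h1 h2).imp_right hbv.trans_lt, fun d t => ?_⟩
  rw [Fin.lt_def] at hab hub hlt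
  rw [Fin.le_def] at hbv
  rcases Nat.lt_or_ge a d with had | had
  · rcases Nat.lt_or_ge b d with hbd | hbd
    · rw [rank_swap_of_lt u had hbd]; exact h d t
    · have hsw := rank_swap_of_le u had hbd t
      rcases Nat.lt_or_ge ((u b : ℕ) + 1) t with ht | ht
      · rw [if_neg (by omega), if_neg (by omega)] at hsw
        have := h d t
        omega
      rcases Nat.lt_or_ge ((u a : ℕ) + 1) t with ht' | ht'
      · -- Between positions `a` and `d`, no entry of `u` lies in the interval `[t, v a]`, whereas
        -- the entry of `v` at `a` does.
        have h1 : rank u d t + rank u a ((v a : ℕ) + 2) = rank u a t + rank u d ((v a : ℕ) + 2) := by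
          clear hsw
          induction d, had using Nat.le_induction with
          | base =>
            have e1 := rank_succ u a t
            have e2 := rank_succ u a ((v a : ℕ) + 2)
            rw [if_neg (by omega)] at e1 e2
            simp only [Nat.succ_eq_add_one]
            omega
          | succ d had ih =>
            have hdn : d < n := by omega
            have e1 := rank_succ u ⟨d, hdn⟩ t
            have e2 := rank_succ u ⟨d, hdn⟩ ((v a : ℕ) + 2)
            have := ih (by omega)
            have h3 := hno ⟨d, hdn⟩ had (by rw [Fin.lt_def]; exact hbd)
            rw [Fin.lt_def, Fin.lt_def] at h3
            simp only at e1 e2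
            split_ifs at e1 e2 <;> omega
        have h2 : rank v a t + 1 + rank v d ((v a : ℕ) + 2) ≤
            rank v d t + rank v a ((v a : ℕ) + 2) := by
          clear hsw h1
          induction d, had using Nat.le_induction with
          | base =>
            have e1 := rank_succ v a t
            have e2 := rank_succ v a ((v a : ℕ) + 2)
            rw [if_pos (by omega)] at e1
            rw [if_neg (by omega)] at e2
            simp only [Nat.succ_eq_add_one]
            omega
          | succ d had ih =>
            have hdn : d < n := by omega
            have e1 := rank_succ v ⟨d, hdn⟩ t
            have e2 := rank_succ v ⟨d, hdn⟩ ((v a : ℕ) + 2)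
            have := ih (by omega)
            simp only at e1 e2
            split_ifs at e1 e2 <;> omega
        have h3 := h d ((v a : ℕ) + 2)
        rw [hrank, hrank] at h1
        rw [if_neg (by omega), if_pos ht] at hsw
        omega
      · rw [if_pos ht', if_pos ht] at hsw
        have := h d t
        omega
  · rw [rank_swap_of_le_left u had (by omega)]; exact h d t

/-- The tableau criterion for the Bruhat order. -/
theorem bruhatLE_of_rank_le {u v : Equiv.Perm (Fin n)} (h : ∀ d t, rank u d t ≤ rank v d t) :
    BruhatLE u v := by
  induction hm : n * n - inversions u using Nat.strong_induction_on generalizing u with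
  | _ m ih =>
    by_cases hne : u = v
    · subst hne; exact Relation.ReflTransGen.refl
    obtain ⟨u', hu', hle⟩ := exists_bruhatCover_of_rank_le hne h
    have h1 := hu'.2
    have h2 := inversions_le u'
    exact Relation.ReflTransGen.head hu' (ih _ (by omega) hle rfl)

/-! ### Sorted initial segments -/

/-- The first `c` entries of `u` in decreasing order. -/
def sortedDesc (u : Equiv.Perm (Fin n)) (c : ℕ) : List ℕ :=
  ((firstEntries u c).sort (· ≤ ·)).reverse

theorem mem_sortedDesc {u : Equiv.Perm (Fin n)} {c x : ℕ} :
    x ∈ sortedDesc u c ↔ ∃ k : Fin n, (k : ℕ) < c ∧ (u k : ℕ) + 1 = x := by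
  simp [sortedDesc, firstEntries]

theorem pairwise_sortedDesc (u : Equiv.Perm (Fin n)) (c : ℕ) :
    (sortedDesc u c).Pairwise (· > ·) := by
  rw [sortedDesc, List.pairwise_reverse]
  exact (Finset.sortedLT_sort _).pairwise

theorem countGE_sortedDesc (u : Equiv.Perm (Fin n)) (c t : ℕ) :
    countGE (sortedDesc u c) t = rank u c t := by
  have h1 : countGE (sortedDesc u c) t = ((firstEntries u c).filter (t ≤ ·)).card := by
    rw [countGE, sortedDesc, List.countP_reverse, ← Multiset.coe_countP, Finset.sort_eq,
      Multiset.countP_eq_card_filter]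
    rfl
  rw [h1, firstEntries, Finset.filter_image, Finset.card_image_of_injective, Finset.filter_filter,
    rank]
  intro a b hab
  exact u.injective (Fin.ext (by simpa using hab))

theorem length_sortedDesc (u : Equiv.Perm (Fin n)) {c : ℕ} (hc : c ≤ n) :
    (sortedDesc u c).length = c := by
  rw [sortedDesc, List.length_reverse, Finset.length_sort, firstEntries,
    Finset.card_image_of_injective]
  · simp [Fin.card_filter_val_lt, hc]
  · intro a b hab
    exact u.injective (Fin.ext (by simpa using hab))

theorem sortedEntry_eq_getD (u : Equiv.Perm (Fin n)) {c i : ℕ} (hc : c ≤ n) (hi : i < c) :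
    sortedEntry u c i = (sortedDesc u c).getD (c - 1 - i) 0 := by
  have hl := length_sortedDesc u hc
  rw [sortedDesc, List.length_reverse] at hl
  rw [sortedEntry, sortedDesc, List.getD_eq_getElem _ _ (by omega),
    List.getD_eq_getElem _ _ (by rw [List.length_reverse]; omega), List.getElem_reverse]
  congr 1
  omega

theorem sortedEntry_lt_iff (u : Equiv.Perm (Fin n)) {c i : ℕ} (hc : c ≤ n) (hi : i < c) (t : ℕ) :
    sortedEntry u c i < t ↔ i + rank u c t < c := by
  rw [sortedEntry_eq_getD u hc hi, getD_lt_iff (pairwise_sortedDesc u c)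
    (by rw [length_sortedDesc u hc]; omega), countGE_sortedDesc]
  omega

/-! ### Columns of fillings and scanning -/

theorem mem_diagram_iff {lam : DomPartition n} {i j : ℕ} :
    (i, j) ∈ lam.diagram ↔ i < lam.col j := YoungDiagram.mem_iff_lt_colLen

theorem col_anti (lam : DomPartition n) {j k : ℕ} (h : j ≤ k) : lam.col k ≤ lam.col j :=
  lam.diagram.colLen_anti j k h

theorem col_le (lam : DomPartition n) (j : ℕ) : lam.col j ≤ n := by
  by_contra h
  have hmem : (n, j) ∈ lam.diagram := mem_diagram_iff.2 (not_le.1 h)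
  rw [DomPartition.diagram, YoungDiagram.mem_ofRowLens] at hmem
  obtain ⟨h, -⟩ := hmem
  simp at h

theorem lt_numCols {lam : DomPartition n} {i j : ℕ} (h : i < lam.col j) : j < lam.numCols :=
  YoungDiagram.mem_iff_lt_rowLen.1 (mem_diagram_iff.2 ((Nat.zero_le i).trans_lt h))

@[simp] theorem length_columnUp (lam : DomPartition n) (F : Filling) (j : ℕ) :
    (columnUp lam F j).length = lam.col j := by simp [columnUp]

theorem pairwise_columnUp {lam : DomPartition n} (T : SemistandardYoungTableau lam.diagram)
    (j : ℕ) : (columnUp lam T j).Pairwise (· > ·) := by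
  rw [columnUp, List.pairwise_map, List.pairwise_reverse]
  refine List.Pairwise.imp_of_mem ?_ List.pairwise_lt_range
  intro a b _ hb hab
  exact T.col_strict hab (mem_diagram_iff.2 (List.mem_range.1 hb))

theorem topLE_columnUp {lam : DomPartition n} (T : SemistandardYoungTableau lam.diagram)
    {j k : ℕ} (h : j ≤ k) : TopLE (columnUp lam T j) (columnUp lam T k) := by
  unfold columnUp
  have hc := col_anti lam h
  generalize lam.col j = c at hc
  induction c, hc using Nat.le_induction with
  | base =>
    refine TopLE.rows ?_
    rw [List.forall₂_map_left_iff, List.forall₂_map_right_iff, List.forall₂_same]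
    intro i hi
    exact T.row_weak_of_le h (mem_diagram_iff.2 (by simpa using hi))
  | succ c _ ih =>
    rw [List.range_succ, List.reverse_append]
    exact ih.extend _

/-- On semistandard tableaux the right key is the scanning tableau. -/
theorem rightKey_eq_scanningTableau {lam : DomPartition n}
    (T : SemistandardYoungTableau lam.diagram) : rightKey lam T = scanningTableau lam T := by
  funext i j
  rw [rightKey, scanningTableau, rightKeyColumn, scanColumn_eq_foldl_sweep,
    foldl_moveRight_eq_foldl_sweep (pairwise_columnUp T j)]
  · intro B hB
    obtain ⟨k, -, rfl⟩ := List.mem_map.1 hB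
    exact pairwise_columnUp T k
  · rw [← List.map_cons, List.pairwise_map, ← List.range'_succ]
    exact (List.pairwise_lt_range').imp fun h => topLE_columnUp T h.le

/-- The values of the scanning paths that begin in column `j`, after `k` further columns. -/
def partialScan (lam : DomPartition n) (F : Filling) (j k : ℕ) : List ℕ :=
  ((List.range' (j + 1) k).map (columnUp lam F)).foldl sweep (columnUp lam F j)

section PartialScan

variable {lam : DomPartition n} {F : Filling}

theorem partialScan_zero (j : ℕ) : partialScan lam F j 0 = columnUp lam F j := rfl

theorem partialScan_succ (hF : ∀ j, (columnUp lam F j).Pairwise (· > ·)) (j k : ℕ) :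
    partialScan lam F j (k + 1) =
      (columnUp lam F (j + 1 + k)).foldl raise (partialScan lam F j k) := by
  rw [partialScan, List.range'_concat, List.map_append, List.foldl_append, one_mul,
    ← sweep_eq_foldl_raise _ (hF _)]
  rfl

theorem length_partialScan (hF : ∀ j, (columnUp lam F j).Pairwise (· > ·)) (j k : ℕ) :
    (partialScan lam F j k).length = lam.col j := by
  induction k with
  | zero => exact length_columnUp lam F j
  | succ k ih => rw [partialScan_succ hF, length_foldl_raise, ih]

theorem pairwise_partialScan (hF : ∀ j, (columnUp lam F j).Pairwise (· > ·)) (j k : ℕ) :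
    (partialScan lam F j k).Pairwise (· > ·) := by
  induction k with
  | zero => exact hF j
  | succ k ih => rw [partialScan_succ hF]; exact pairwise_foldl_raise ih _

/-- Comparison with a key in terms of counting functions. -/
theorem fillingLE_scanningTableau_iff (hF : ∀ j, (columnUp lam F j).Pairwise (· > ·))
    (w : Equiv.Perm (Fin n)) :
    FillingLE lam (scanningTableau lam F) (keyOf lam w) ↔ ∀ j t,
      countGE (partialScan lam F j (lam.numCols - (j + 1))) t ≤ rank w (lam.col j) t := by
  have hS : ∀ i j, scanningTableau lam F i j =
      (partialScan lam F j (lam.numCols - (j + 1))).getD (lam.col j - 1 - i) 0 := fun i j => by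
    rw [scanningTableau, scanColumn_eq_foldl_sweep]
    rfl
  have hlt : ∀ i j, i < lam.col j → ∀ t, scanningTableau lam F i j < t ↔
      i + countGE (partialScan lam F j (lam.numCols - (j + 1))) t < lam.col j := by
    intro i j hi t
    rw [hS, getD_lt_iff (pairwise_partialScan hF _ _)
      (by rw [length_partialScan hF]; omega)]
    omega
  have hkey : ∀ i j, i < lam.col j → ∀ t, keyOf lam w i j < t ↔
      i + rank w (lam.col j) t < lam.col j :=
    fun i j hi t => sortedEntry_lt_iff w (col_le lam j) hi t
  constructor
  · intro h j t
    by_contra hcon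
    have h1 := countGE_le_length (partialScan lam F j (lam.numCols - (j + 1))) t
    rw [length_partialScan hF] at h1
    -- The box whose entry decides between the two counts.
    have hi : lam.col j - 1 - rank w (lam.col j) t < lam.col j := by omega
    have h2 := h _ j (mem_diagram_iff.2 hi)
    have h3 := (hkey _ j hi t).2 (by omega)
    have h4 := (hlt _ j hi t).1 (h2.trans_lt h3)
    omega
  · intro h i j hij
    have hi := mem_diagram_iff.1 hij
    by_contra hcon
    have h1 := (hkey i j hi _).1 (not_le.1 hcon)
    have h2 := (hlt i j hi (scanningTableau lam F i j)).2
      (by have := h j (scanningTableau lam F i j); omega)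
    exact lt_irrefl _ h2

end PartialScan

/-- A permutation whose first `c` entries contain `B` and dominate `L` also dominates the outcome
of raising `L` by `B`: raising is minimal. -/
theorem countGE_foldl_raise_le {u : Equiv.Perm (Fin n)} {c : ℕ} {L B : List ℕ}
    (hL : L.Pairwise (· > ·)) (h : ∀ t, countGE L t ≤ rank u c t)
    (hB : ∀ b ∈ B, ∃ k : Fin n, (k : ℕ) < c ∧ (u k : ℕ) + 1 = b) (t : ℕ) :
    countGE (B.foldl raise L) t ≤ rank u c t := by
  induction B generalizing L with
  | nil => exact h t
  | cons b B ih =>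
    refine ih (pairwise_raise hL b) (fun t => ?_) fun x hx => hB x (by simp [hx])
    obtain ⟨k, hk, hb⟩ := hB b (by simp)
    rcases Nat.lt_or_ge b t with hbt | hbt
    · rw [countGE_raise_of_lt hbt]; exact h t
    · have h1 := countGE_raise_le hL hbt
      have h2 := rank_lt u hk (s := t) (t := b + 1) (by omega) (by omega)
      have h3 := h t
      have h4 := h (b + 1)
      omega

/-! ### The tableaux of admissible subsets -/

section Chain

variable {lam : DomPartition n} {J : Finset (Fin (gamma lam).length)}

theorem rank_chainPerm_mono (hJ : Admissible lam J) {m m' : ℕ} (h : m ≤ m') (d t : ℕ) :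
    rank (chainPerm lam J m) d t ≤ rank (chainPerm lam J m') d t := by
  induction m', h using Nat.le_induction with
  | base => exact le_rfl
  | succ m' _ ih =>
    refine ih.trans ?_
    by_cases hm : ∃ h : m' < (gamma lam).length, (⟨m', h⟩ : Fin _) ∈ J
    · obtain ⟨h, hm⟩ := hm
      exact (hJ _ hm).rank_le d t
    · have : chainPerm lam J (m' + 1) = chainPerm lam J m' := by
        rw [chainPerm]
        split_ifs with h1 h2
        · exact absurd ⟨h1, h2⟩ hm
        · rfl
        · rfl
      rw [this]

theorem length_gammaPrefix_mono (lam : DomPartition n) {j k : ℕ} (h : j ≤ k) :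
    (gammaPrefix lam j).length ≤ (gammaPrefix lam k).length := by
  induction k, h using Nat.le_induction with
  | base => exact le_rfl
  | succ k _ ih =>
    refine ih.trans ?_
    rw [gammaPrefix, gammaPrefix, List.range_succ, List.flatMap_append, List.length_append]
    exact Nat.le_add_right _ _

/-- The permutation reached after the first `j` segments. -/
def segPerm (lam : DomPartition n) (J : Finset (Fin (gamma lam).length)) (j : ℕ) :
    Equiv.Perm (Fin n) :=
  chainPerm lam J (gammaPrefix lam j).length

theorem rank_segPerm_mono (hJ : Admissible lam J) {j k : ℕ} (h : j ≤ k) (d t : ℕ) :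
    rank (segPerm lam J j) d t ≤ rank (segPerm lam J k) d t :=
  rank_chainPerm_mono hJ (length_gammaPrefix_mono lam h) d t

theorem tableauOf_lt_iff {i j : ℕ} (hi : i < lam.col j) (t : ℕ) :
    tableauOf lam J i j < t ↔ i + rank (segPerm lam J (j + 1)) (lam.col j) t < lam.col j := by
  rw [tableauOf, if_pos (mem_diagram_iff.2 hi), sortedEntry_lt_iff _ (col_le lam j) hi]
  rfl

theorem columnUp_tableauOf (j : ℕ) :
    columnUp lam (tableauOf lam J) j = sortedDesc (segPerm lam J (j + 1)) (lam.col j) := by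
  have hl := length_sortedDesc (segPerm lam J (j + 1)) (col_le lam j)
  refine List.ext_getElem (by rw [length_columnUp, hl]) fun i h1 h2 => ?_
  rw [length_columnUp] at h1
  have hi : lam.col j - 1 - i < lam.col j := by omega
  simp only [columnUp, List.getElem_map, List.getElem_reverse, List.length_range,
    List.getElem_range]
  rw [tableauOf, if_pos (mem_diagram_iff.2 hi), sortedEntry_eq_getD _ (col_le lam j) hi]
  have : lam.col j - 1 - (lam.col j - 1 - i) = i := by omega
  rw [this, ← List.getD_eq_getElem _ 0 h2]
  rfl

/-- The tableau of an admissible subset, as a semistandard tableau. -/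
def semistandardOf (hJ : Admissible lam J) : SemistandardYoungTableau lam.diagram where
  entry := tableauOf lam J
  row_weak' := by
    intro i j1 j2 hj hi
    rw [mem_diagram_iff] at hi
    have hc := col_anti lam hj.le
    by_contra hcon
    have h1 := (tableauOf_lt_iff hi _).1 (not_le.1 hcon)
    have h2 := rank_segPerm_mono hJ (Nat.succ_le_succ hj.le) (lam.col j2) (tableauOf lam J i j1)
    have h3 := rank_le_add (segPerm lam J (j1 + 1)) hc (col_le lam j1) (tableauOf lam J i j1)
    have h4 := (tableauOf_lt_iff (J := J) (hi.trans_le hc) (tableauOf lam J i j1)).2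
      (by simp only [Nat.succ_eq_add_one] at h2; omega)
    exact lt_irrefl _ h4
  col_strict' := by
    intro i1 i2 j hi h2
    rw [mem_diagram_iff] at h2
    have hp : (columnUp lam (tableauOf lam J) j).Pairwise (· > ·) := by
      rw [columnUp_tableauOf]; exact pairwise_sortedDesc _ _
    rw [columnUp, List.pairwise_map, List.pairwise_reverse, List.pairwise_iff_getElem] at hp
    have h3 := hp i1 i2 (by simpa using hi.trans h2) (by simpa using h2) hi
    simpa only [List.getElem_range] using h3
  zeros' := fun h => by rw [tableauOf, if_neg h]

theorem hasLetters_semistandardOf (hJ : Admissible lam J) :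
    HasLetters lam (semistandardOf hJ) := by
  intro i j hij
  have hi := mem_diagram_iff.1 hij
  have hmem : tableauOf lam J i j ∈ columnUp lam (tableauOf lam J) j :=
    List.mem_map.2 ⟨i, by simpa using hi, rfl⟩
  rw [columnUp_tableauOf, mem_sortedDesc] at hmem
  obtain ⟨k, -, hk⟩ := hmem
  change 1 ≤ tableauOf lam J i j ∧ tableauOf lam J i j ≤ n
  have := (segPerm lam J (j + 1) k).isLt
  omega

theorem countGE_partialScan_tableauOf_le (hJ : Admissible lam J) (j k t : ℕ) :
    countGE (partialScan lam (tableauOf lam J) j k) t ≤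
      rank (segPerm lam J (j + 1 + k)) (lam.col j) t := by
  have hF : ∀ j, (columnUp lam (tableauOf lam J) j).Pairwise (· > ·) := fun j => by
    rw [columnUp_tableauOf]; exact pairwise_sortedDesc _ _
  induction k generalizing t with
  | zero => rw [partialScan_zero, columnUp_tableauOf, countGE_sortedDesc, add_zero]
  | succ k ih =>
    rw [partialScan_succ hF, ← add_assoc]
    refine countGE_foldl_raise_le (pairwise_partialScan hF _ _)
      (fun t => (ih t).trans (rank_segPerm_mono hJ (Nat.le_succ _) _ _)) ?_ t
    intro b hb
    rw [columnUp_tableauOf, mem_sortedDesc] at hb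
    obtain ⟨x, hx, rfl⟩ := hb
    exact ⟨x, hx.trans_le (col_anti lam (by omega)), rfl⟩

theorem alcoveTableaux_subset (w : Equiv.Perm (Fin n)) :
    alcoveTableaux lam w ⊆ scanningTableaux lam w := by
  rintro _ ⟨J, ⟨hJ, hw⟩, rfl⟩
  refine ⟨semistandardOf hJ, rfl, hasLetters_semistandardOf hJ, ?_⟩
  rw [fillingLE_scanningTableau_iff]
  · intro j t
    rcases Nat.lt_or_ge j lam.numCols with hj | hj
    · have h := countGE_partialScan_tableauOf_le hJ j (lam.numCols - (j + 1)) t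
      rw [show j + 1 + (lam.numCols - (j + 1)) = lam.numCols by omega] at h
      exact h.trans (hw.rank_le _ t)
    · have h0 : lam.col j = 0 := by
        by_contra h
        exact absurd (lt_numCols (Nat.pos_of_ne_zero h)) (not_lt.2 hj)
      have h := countGE_partialScan_tableauOf_le hJ j (lam.numCols - (j + 1)) t
      rw [h0, rank_zero] at h
      omega
  · exact fun j => pairwise_columnUp (semistandardOf hJ) j

end Chain

/-! ### The greedy chain -/

/-- `v` is reached from `u` by a saturated Bruhat chain which applies some of the transpositions in
the list, in order. -/
def Reach : List (Fin n × Fin n) → Equiv.Perm (Fin n) → Equiv.Perm (Fin n) → Prop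
  | [], u, v => v = u
  | x :: L, u, v => Reach L u v ∨
      (BruhatCover u (u * Equiv.swap x.1 x.2) ∧ Reach L (u * Equiv.swap x.1 x.2) v)

theorem Reach.append {L M : List (Fin n × Fin n)} {u v w : Equiv.Perm (Fin n)}
    (h : Reach L u v) (h' : Reach M v w) : Reach (L ++ M) u w := by
  induction L generalizing u with
  | nil =>
    obtain rfl : v = u := h
    exact h'
  | cons x L ih => exact h.imp ih fun h => ⟨h.1, ih h.2⟩

/-- One step of the greedy chain: the entry `u k` is exchanged with the entry at position `i` if
this moves the latter upwards, but not beyond `b`. -/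
def climbStep (i : Fin n) (b : ℕ) (u : Equiv.Perm (Fin n)) (k : Fin n) : Equiv.Perm (Fin n) :=
  if u i < u k ∧ (u k : ℕ) + 1 ≤ b then u * Equiv.swap i k else u

/-- The greedy chain for one position `i` along the positions in a list. -/
def climb (i : Fin n) (b : ℕ) (K : List (Fin n)) (u : Equiv.Perm (Fin n)) : Equiv.Perm (Fin n) :=
  K.foldl (climbStep i b) u

section Climb

variable {i : Fin n} {b : ℕ}

theorem climb_cons (k : Fin n) (K : List (Fin n)) (u : Equiv.Perm (Fin n)) :
    climb i b (k :: K) u = climb i b K (climbStep i b u k) := rfl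

theorem climbStep_apply_of_ne (u : Equiv.Perm (Fin n)) {k p : Fin n} (hi : p ≠ i) (hk : p ≠ k) :
    climbStep i b u k p = u p := by
  rw [climbStep]
  split_ifs
  · simp [Equiv.swap_apply_of_ne_of_ne hi hk]
  · rfl

theorem le_climbStep (u : Equiv.Perm (Fin n)) (k : Fin n) : u i ≤ climbStep i b u k i := by
  rw [climbStep]
  split_ifs with h
  · simpa using h.1.le
  · exact le_rfl

theorem climbStep_le {u : Equiv.Perm (Fin n)} (h : (u i : ℕ) + 1 ≤ b) (k : Fin n) :
    (climbStep i b u k i : ℕ) + 1 ≤ b := by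
  rw [climbStep]
  split_ifs with h'
  · simpa using h'.2
  · exact h

theorem climbStep_apply_lt (u : Equiv.Perm (Fin n)) {k : Fin n} (hk : k ≠ i) :
    climbStep i b u k k < climbStep i b u k i ∨ b < (climbStep i b u k k : ℕ) + 1 := by
  rw [climbStep]
  split_ifs with h
  · simp [h.1]
  · by_contra hcon
    push Not at hcon
    exact h ⟨lt_of_le_of_ne hcon.1 fun he => hk (u.injective he).symm, hcon.2⟩

theorem climbStep_apply_le (u : Equiv.Perm (Fin n)) (k : Fin n) : climbStep i b u k k ≤ u k := by
  rw [climbStep]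
  split_ifs with h
  · simpa using h.1.le
  · exact le_rfl

theorem climb_apply_of_notMem {K : List (Fin n)} (u : Equiv.Perm (Fin n)) {p : Fin n} (hi : p ≠ i)
    (hp : p ∉ K) : climb i b K u p = u p := by
  induction K generalizing u with
  | nil => rfl
  | cons k K ih =>
    rw [List.mem_cons, not_or] at hp
    rw [climb_cons, ih _ hp.2, climbStep_apply_of_ne u hi hp.1]

theorem le_climb (K : List (Fin n)) (u : Equiv.Perm (Fin n)) : u i ≤ climb i b K u i := by
  induction K generalizing u with
  | nil => exact le_rfl
  | cons k K ih => exact (le_climbStep u k).trans (ih _)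

theorem climb_le {u : Equiv.Perm (Fin n)} (h : (u i : ℕ) + 1 ≤ b) (K : List (Fin n)) :
    (climb i b K u i : ℕ) + 1 ≤ b := by
  induction K generalizing u with
  | nil => exact h
  | cons k K ih => exact ih (climbStep_le h k)

theorem climb_apply_lt {K : List (Fin n)} (hi : i ∉ K) (hK : K.Nodup) (u : Equiv.Perm (Fin n))
    {k : Fin n} (hk : k ∈ K) :
    climb i b K u k < climb i b K u i ∨ b < (climb i b K u k : ℕ) + 1 := by
  induction K generalizing u with
  | nil => simp at hk
  | cons x K ih =>
    rw [List.mem_cons, not_or] at hi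
    rw [List.nodup_cons] at hK
    rw [climb_cons]
    rcases List.mem_cons.1 hk with rfl | hk
    · rw [climb_apply_of_notMem _ (Ne.symm hi.1) hK.1]
      exact (climbStep_apply_lt u (Ne.symm hi.1)).imp_left fun h => h.trans_le (le_climb K _)
    · exact ih hi.2 hK.2 _ hk

/-- The entry at `i` reaches the value `b` if this value is met on the way. -/
theorem climb_apply_eq {K : List (Fin n)} (hi : i ∉ K) (hK : K.Nodup) {u : Equiv.Perm (Fin n)}
    (h : (u i : ℕ) + 1 ≤ b) {k : Fin n} (hk : k ∈ K) (hb : (u k : ℕ) + 1 = b) :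
    (climb i b K u i : ℕ) + 1 = b := by
  induction K generalizing u with
  | nil => simp at hk
  | cons x K ih =>
    rw [List.mem_cons, not_or] at hi
    rw [List.nodup_cons] at hK
    rw [climb_cons]
    rcases List.mem_cons.1 hk with rfl | hk'
    · refine le_antisymm (climb_le (climbStep_le h k) K) ?_
      have h1 := le_climb (i := i) (b := b) K (climbStep i b u k)
      have h2 : climbStep i b u k i = u k := by
        rw [climbStep, if_pos]
        · simp
        · refine ⟨lt_of_le_of_ne ?_ fun he => hi.1 (u.injective he), hb.le⟩
          rw [Fin.le_def]
          omega
      rw [h2, Fin.le_def] at h1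
      omega
    · refine ih hi.2 hK.2 (climbStep_le h x) hk' ?_
      rw [climbStep_apply_of_ne u, hb]
      · rintro rfl; exact hi.2 hk'
      · rintro rfl; exact hK.1 hk'

theorem lt_climb_apply {K : List (Fin n)} (hi : i ∉ K) (hK : K.Nodup) {u : Equiv.Perm (Fin n)}
    {y k : Fin n} (hy : y < u i ∨ b < (y : ℕ) + 1) (hk : k ∈ K) (hyk : y < u k) :
    y < climb i b K u k := by
  induction K generalizing u with
  | nil => simp at hk
  | cons x K ih =>
    rw [List.mem_cons, not_or] at hi
    rw [List.nodup_cons] at hK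
    rw [climb_cons]
    rcases List.mem_cons.1 hk with rfl | hk'
    · rw [climb_apply_of_notMem _ (Ne.symm hi.1) hK.1, climbStep]
      split_ifs with h
      · rw [Fin.lt_def] at hyk
        simpa using hy.resolve_right (by omega)
      · exact hyk
    · refine ih hi.2 hK.2 (hy.imp_left fun h => h.trans_le (le_climbStep u x)) hk' ?_
      rwa [climbStep_apply_of_ne u]
      · rintro rfl; exact hi.2 hk'
      · rintro rfl; exact hK.1 hk'

/-- Ascents among the positions passed survive. -/
theorem climb_apply_lt_climb_apply {K : List (Fin n)} (hi : i ∉ K) (hK : K.Pairwise (· < ·))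
    {u : Equiv.Perm (Fin n)} {k l : Fin n} (hk : k ∈ K) (hl : l ∈ K) (hkl : k < l)
    (hu : u k < u l) : climb i b K u k < climb i b K u l := by
  induction K generalizing u with
  | nil => simp at hk
  | cons x K ih =>
    rw [List.mem_cons, not_or] at hi
    rw [List.pairwise_cons] at hK
    have hnd : K.Nodup := hK.2.imp fun h => h.ne
    have hx : x ∉ K := fun h => (hK.1 x h).false
    rw [climb_cons]
    rcases List.mem_cons.1 hl with rfl | hl'
    · rcases List.mem_cons.1 hk with rfl | hk'
      · exact absurd hkl (lt_irrefl _)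
      · exact absurd (hK.1 k hk') hkl.asymm
    have hli : l ≠ i := by rintro rfl; exact hi.2 hl'
    have hlx : l ≠ x := by rintro rfl; exact hx hl'
    rcases List.mem_cons.1 hk with rfl | hk'
    · rw [climb_apply_of_notMem _ (Ne.symm hi.1) hx]
      refine lt_climb_apply hi.2 hnd (climbStep_apply_lt u (Ne.symm hi.1)) hl' ?_
      rw [climbStep_apply_of_ne u hli hlx]
      exact (climbStep_apply_le u k).trans_lt hu
    · refine ih hi.2 hK.2 hk' hl' ?_
      rw [climbStep_apply_of_ne u hli hlx, climbStep_apply_of_ne u]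
      · exact hu
      · rintro rfl; exact hi.2 hk'
      · rintro rfl; exact hx hk'

/-- The greedy chain is saturated: an entry strictly between the two that are exchanged, in
position and in value, would have been taken up before. -/
theorem reach_climb {K : List (Fin n)} (hi : ∀ k ∈ K, i < k) (hK : K.Pairwise (· < ·))
    {u : Equiv.Perm (Fin n)}
    (h : ∀ p, i < p → p ∉ K → u p < u i ∨ b < (u p : ℕ) + 1) :
    Reach (K.map fun k => (i, k)) u (climb i b K u) := by
  induction K generalizing u with
  | nil => rfl
  | cons k K ih =>
    rw [List.pairwise_cons] at hK
    have hik : i < k := hi k (by simp)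
    have hrec : Reach (K.map fun k => (i, k)) (climbStep i b u k) (climb i b (k :: K) u) := by
      refine ih (fun x hx => hi x (by simp [hx])) hK.2 fun p hip hp => ?_
      rcases eq_or_ne p k with rfl | hpk
      · exact climbStep_apply_lt u hip.ne'
      · rw [climbStep_apply_of_ne u hip.ne' hpk]
        exact (h p hip (by simp [hpk, hp])).imp_left fun h => h.trans_le (le_climbStep u k)
    rw [climbStep] at hrec
    split_ifs at hrec with hc
    · refine Or.inr ⟨bruhatCover_swap u hik hc.1 fun p hip hpk => ?_, hrec⟩
      refine (h p hip fun hp => ?_).imp_right fun h => ?_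
      · rcases List.mem_cons.1 hp with rfl | hp
        · exact hpk.false
        · exact (hK.1 p hp).asymm hpk
      · change u k < u p
        rw [Fin.lt_def]
        have := hc.2
        omega
    · exact Or.inl hrec

theorem rank_climb_of_lt {K : List (Fin n)} {d : ℕ} (hi : (i : ℕ) < d)
    (hK : ∀ k ∈ K, (k : ℕ) < d) (u : Equiv.Perm (Fin n)) (t : ℕ) :
    rank (climb i b K u) d t = rank u d t := by
  induction K generalizing u with
  | nil => rfl
  | cons k K ih =>
    rw [climb_cons, ih (fun x hx => hK x (by simp [hx])), climbStep]
    split_ifs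
    · exact rank_swap_of_lt u hi (hK k (by simp)) t
    · rfl

end Climb

/-- The positions `≥ c` in increasing order. -/
def positionsGE (n c : ℕ) : List (Fin n) := (List.finRange n).filter fun k : Fin n => c ≤ (k : ℕ)

theorem mem_positionsGE {c : ℕ} {k : Fin n} : k ∈ positionsGE n c ↔ c ≤ (k : ℕ) := by
  simp [positionsGE]

theorem pairwise_positionsGE (n c : ℕ) : (positionsGE n c).Pairwise (· < ·) :=
  (List.pairwise_lt_finRange n).filter _

theorem positionsGE_split {c d : ℕ} (h : c ≤ d) :
    positionsGE n c = (positionsGE n c).filter (fun k : Fin n => (k : ℕ) < d) ++ positionsGE n d := by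
  refine (pairwise_positionsGE n c).eq_of_mem_iff ?_ fun k => ?_
  · refine List.pairwise_append.2 ⟨(pairwise_positionsGE n c).filter _,
      pairwise_positionsGE n d, fun a ha b hb => ?_⟩
    rw [List.mem_filter] at ha
    rw [mem_positionsGE] at hb
    have := of_decide_eq_true ha.2
    rw [Fin.lt_def]
    omega
  · rw [List.mem_append, List.mem_filter, mem_positionsGE, mem_positionsGE, decide_eq_true_eq]
    omega

/-- After the greedy chain for one position `i`, the initial segments have been raised: the largest
of their entries not exceeding `b` has been replaced by `b`. -/
theorem rank_climb {u : Equiv.Perm (Fin n)} {i : Fin n} {b c d : ℕ} (hic : (i : ℕ) < c)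
    (hcd : c ≤ d) (hle : (u i : ℕ) + 1 ≤ b)
    (hu : ∀ p : Fin n, (p : ℕ) < c → p ≠ i → u p < u i ∨ b < (u p : ℕ) + 1)
    (hb : (climb i b (positionsGE n c) u i : ℕ) + 1 = b) (t : ℕ) :
    rank (climb i b (positionsGE n c) u) d t =
      if t ≤ b then max (rank u d t) (rank u d (b + 1) + 1) else rank u d t := by
  set K := (positionsGE n c).filter fun k : Fin n => (k : ℕ) < d with hKdef
  have hsplit := positionsGE_split (n := n) hcd
  rw [← hKdef] at hsplit
  set v := climb i b (positionsGE n c) u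
  -- The state of the chain when it leaves the first `d` positions
  set x := climb i b K u with hx
  have hvx : v = climb i b (positionsGE n d) x := by
    simp only [v, x]
    rw [hsplit, climb, List.foldl_append]
    rfl
  have hmemK : ∀ k ∈ K, c ≤ (k : ℕ) ∧ (k : ℕ) < d := fun k hk => by
    rw [hKdef, List.mem_filter, mem_positionsGE] at hk
    exact ⟨hk.1, of_decide_eq_true hk.2⟩
  have hiK : i ∉ K := fun h => by have := (hmemK i h).1; omega
  have hKnd : K.Nodup := ((pairwise_positionsGE n c).filter _).imp fun h => h.ne
  have hxle : (x i : ℕ) + 1 ≤ b := climb_le hle K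
  have hux : u i ≤ x i := le_climb K u
  have hxu : ∀ t, rank x d t = rank u d t :=
    rank_climb_of_lt (by omega) (fun k hk => (hmemK k hk).2) u
  have hbelow : ∀ k : Fin n, (k : ℕ) < d → k ≠ i → x k < x i ∨ b < (x k : ℕ) + 1 := by
    intro k hkd hki
    by_cases hk : k ∈ K
    · exact climb_apply_lt hiK hKnd u hk
    · have hkc : (k : ℕ) < c := by
        by_contra hcon
        apply hk
        rw [hKdef, List.mem_filter, mem_positionsGE]
        exact ⟨not_lt.1 hcon, decide_eq_true hkd⟩
      rw [hx, climb_apply_of_notMem u hki hk, ← hx]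
      exact (hu k hkc hki).imp_left fun h => h.trans_le hux
  have hup := rank_update (u := x) (v := v) (d := d) (i := i) (by omega) (fun k hkd hki => by
    rw [hvx, climb_apply_of_notMem x hki]
    rw [mem_positionsGE]
    omega) t
  rw [hb, hxu] at hup
  rcases Nat.lt_or_ge b t with htb | htb
  · rw [if_neg (not_le.2 htb)]
    rw [if_neg (by omega), if_neg (by omega)] at hup
    exact hup
  rw [if_pos htb]
  rw [if_pos htb] at hup
  rcases Nat.lt_or_ge ((x i : ℕ) + 1) t with hxt | hxt
  · have : rank x d t = rank x d (b + 1) := by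
      unfold rank
      congr 1
      refine Finset.filter_congr fun k _ => and_congr_right fun hkd => ?_
      rcases eq_or_ne k i with rfl | hki
      · omega
      · have := hbelow k hkd hki
        rw [Fin.lt_def] at this
        omega
    rw [hxu, hxu] at this
    rw [if_neg (by omega)] at hup
    omega
  · have := rank_lt x (i := i) (d := d) (by omega) hxt (t := b + 1) (by omega)
    rw [hxu, hxu] at this
    rw [if_pos hxt] at hup
    omega

/-- The part of `Γ(c)` in which the first position is less than `m`. -/
def gammaRows (n c m : ℕ) : List (Fin n × Fin n) :=
  ((List.finRange n).filter fun i : Fin n => (i : ℕ) < m).reverse.flatMap fun i =>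
    (positionsGE n c).map fun k => (i, k)

theorem gammaRows_succ {c m : ℕ} (h : m < n) : gammaRows n c (m + 1) =
    ((positionsGE n c).map fun k => ((⟨m, h⟩ : Fin n), k)) ++ gammaRows n c m := by
  have : ((List.finRange n).filter fun i : Fin n => (i : ℕ) < m + 1) =
      ((List.finRange n).filter fun i : Fin n => (i : ℕ) < m) ++ [⟨m, h⟩] := by
    refine ((List.pairwise_lt_finRange n).filter _).eq_of_mem_iff (r := (· < ·)) ?_ fun k => ?_
    · refine List.pairwise_append.2 ⟨(List.pairwise_lt_finRange n).filter _, by simp,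
        fun a ha b hb => ?_⟩
      rw [List.mem_singleton] at hb
      rw [hb, Fin.lt_def]
      exact of_decide_eq_true (List.mem_filter.1 ha).2
    · simp [Fin.ext_iff]
      omega
  rw [gammaRows, this, List.reverse_append]
  rfl

/-- Within the segment `Γ(c)` there is a saturated chain from `u` to a permutation whose first `c`
entries are `b 0 < ⋯ < b (c - 1)`, provided that the first `c` entries of `u` increase and are
entrywise at most these. It raises every longer initial segment by `b (c - 1), …, b 0`, and
no ascent is lost beyond position `c`. For the induction, the positions from `m` to `c - 1` have
been treated. -/
theorem exists_reach_gammaRows {b : ℕ → ℕ} {c : ℕ} (hcn : c ≤ n)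
    (hmono : ∀ p q, p < q → q < c → b p < b q) (hbn : ∀ p < c, b p ≤ n) {m : ℕ} (hm : m ≤ c)
    {u : Equiv.Perm (Fin n)} (hinc : ∀ p q : Fin n, p < q → (q : ℕ) < m → u p < u q)
    (hle : ∀ p : Fin n, (p : ℕ) < m → (u p : ℕ) + 1 ≤ b p)
    (hdone : ∀ p : Fin n, m ≤ (p : ℕ) → (p : ℕ) < c → (u p : ℕ) + 1 = b p) :
    ∃ v, Reach (gammaRows n c m) u v ∧ (∀ p : Fin n, (p : ℕ) < c → (v p : ℕ) + 1 = b p) ∧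
      (∀ k l : Fin n, k < l → c ≤ (k : ℕ) → u k < u l → v k < v l) ∧
      ∀ d, c ≤ d → d ≤ n → ∀ L : List ℕ, L.Pairwise (· > ·) → L.length = d →
        (∀ t, countGE L t = rank u d t) →
        ∀ t, countGE (((List.range m).reverse.map b).foldl raise L) t = rank v d t := by
  induction m generalizing u with
  | zero =>
    refine ⟨u, ?_, fun p hp => hdone p (Nat.zero_le _) hp, fun _ _ _ _ h => h,
      fun d _ _ L _ _ hL t => hL t⟩
    simp [gammaRows, Reach]
  | succ m ih =>
    have hmn : m < n := by omega
    set i : Fin n := ⟨m, hmn⟩ with hi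
    have hiv : (i : ℕ) = m := rfl
    have hile : (u i : ℕ) + 1 ≤ b m := hle i (by simp [hi])
    have hiK : i ∉ positionsGE n c := by rw [mem_positionsGE]; omega
    have hKnd : (positionsGE n c).Nodup := (pairwise_positionsGE n c).imp fun h => h.ne
    have hother : ∀ p : Fin n, (p : ℕ) < c → p ≠ i → u p < u i ∨ b m < (u p : ℕ) + 1 := by
      intro p hpc hpi
      rw [Ne, Fin.ext_iff] at hpi
      rcases Nat.lt_or_ge p m with hpm | hpm
      · exact Or.inl (hinc p i hpm (by omega))
      · right
        rw [hdone p (by omega) hpc]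
        exact hmono m p (by omega) hpc
    set v := climb i (b m) (positionsGE n c) u with hv
    have hvb : (v i : ℕ) + 1 = b m := by
      have hbm := hbn m (by omega)
      obtain ⟨q, hq⟩ : ∃ q : Fin n, (u q : ℕ) + 1 = b m := by
        refine ⟨u.symm ⟨b m - 1, by omega⟩, ?_⟩
        simp only [Equiv.apply_symm_apply]
        omega
      rcases Nat.lt_or_ge q c with hqc | hqc
      · rcases eq_or_ne q i with hqi | hqi
        · have h1 := le_climb (i := i) (b := b m) (positionsGE n c) u
          have h2 := climb_le hile (positionsGE n c)
          rw [Fin.le_def, ← hv] at h1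
          rw [← hv] at h2
          rw [hqi] at hq
          omega
        · have := hother q hqc hqi
          rw [Fin.lt_def] at this
          omega
      · exact climb_apply_eq hiK hKnd hile (mem_positionsGE.2 hqc) hq
    have hsame : ∀ p : Fin n, (p : ℕ) < c → p ≠ i → v p = u p := fun p hpc hpi =>
      climb_apply_of_notMem u hpi (by rw [mem_positionsGE]; omega)
    obtain ⟨w, hw1, hw2, hw3, hw4⟩ := ih (u := v) (by omega)
      (fun p q hpq hq => by
        have hpq' := hpq
        rw [Fin.lt_def] at hpq'
        rw [hsame p (by omega) (by rw [Ne, Fin.ext_iff]; omega),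
          hsame q (by omega) (by rw [Ne, Fin.ext_iff]; omega)]
        exact hinc p q hpq (by omega))
      (fun p hp => by
        rw [hsame p (by omega) (by rw [Ne, Fin.ext_iff]; omega)]
        exact hle p (by omega))
      (fun p hp hpc => by
        rcases eq_or_ne p i with rfl | hpi
        · exact hvb
        · rw [hsame p hpc hpi]
          rw [Ne, Fin.ext_iff] at hpi
          exact hdone p (by omega) hpc)
    refine ⟨w, ?_, hw2, fun k l hkl hk hu => hw3 k l hkl hk ?_, ?_⟩
    · rw [gammaRows_succ hmn]
      refine Reach.append (reach_climb (fun k hk => ?_) (pairwise_positionsGE n c)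
        fun p hip hp => ?_) hw1
      · rw [mem_positionsGE] at hk
        rw [Fin.lt_def]
        omega
      · rw [mem_positionsGE] at hp
        exact hother p (by omega) hip.ne'
    · refine climb_apply_lt_climb_apply hiK (pairwise_positionsGE n c) (mem_positionsGE.2 hk)
        (mem_positionsGE.2 ?_) hkl hu
      rw [Fin.lt_def] at hkl
      omega
    · intro d hcd hdn L hL hLd hLu t
      rw [List.range_succ, List.reverse_append, List.map_append, List.foldl_append]
      refine hw4 d hcd hdn _ (pairwise_raise hL (b m)) (by rw [← hLd]; exact length_raise L (b m))
        (fun t => ?_) t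
      have hr := rank_climb (d := d) (by omega) hcd hile hother hvb t
      rw [← hv] at hr
      rw [hr]
      split_ifs with ht
      · rw [countGE_raise hL ht, hLu, hLu]
        -- The entry at position `i` is not counted.
        have h1 := rank_lt u (i := i) (d := d) (s := 0) (t := b m + 1) (by omega) (by omega)
          (by omega)
        have h2 := rank_le u hdn 0
        rw [hLu, hLd]
        omega
      · rw [countGE_raise_of_lt (by omega), hLu]

/-! ### The admissible subset of a tableau -/

/-- A sequence of permutations in which each step either stays or applies the corresponding
transposition of the list, as a cover in the Bruhat order. -/
def IsPath (L : List (Fin n × Fin n)) (p : ℕ → Equiv.Perm (Fin n)) : Prop :=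
  ∀ m (h : m < L.length), p (m + 1) = p m ∨
    (p (m + 1) = p m * Equiv.swap (L[m]).1 (L[m]).2 ∧ BruhatCover (p m) (p (m + 1)))

theorem Reach.exists_isPath {L : List (Fin n × Fin n)} {u v : Equiv.Perm (Fin n)}
    (h : Reach L u v) : ∃ p, IsPath L p ∧ p 0 = u ∧ p L.length = v := by
  induction L generalizing u with
  | nil => exact ⟨fun _ => u, fun m hm => absurd hm (by simp), rfl, h.symm⟩
  | cons x L ih =>
    rcases h with h | ⟨hc, h⟩
    · obtain ⟨p, hp, h0, h1⟩ := ih h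
      refine ⟨fun m => Nat.casesOn m u p, fun m hm => ?_, rfl, h1⟩
      cases m with
      | zero => exact Or.inl h0
      | succ m => exact hp m (by simpa using hm)
    · obtain ⟨p, hp, h0, h1⟩ := ih h
      refine ⟨fun m => Nat.casesOn m u p, fun m hm => ?_, rfl, h1⟩
      cases m with
      | zero => exact Or.inr ⟨h0, by simpa [h0] using hc⟩
      | succ m => exact hp m (by simpa using hm)

theorem IsPath.append {L M : List (Fin n × Fin n)} {p q : ℕ → Equiv.Perm (Fin n)}
    (hp : IsPath L p) (hq : IsPath M q) (h : p L.length = q 0) :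
    IsPath (L ++ M) fun m => if m ≤ L.length then p m else q (m - L.length) := by
  intro m hm
  rcases Nat.lt_or_ge m L.length with hmL | hmL
  · simp only [Nat.succ_le_of_lt hmL, hmL.le, if_true, List.getElem_append_left hmL]
    exact hp m hmL
  · rw [List.length_append] at hm
    have h1 : (if m ≤ L.length then p m else q (m - L.length)) = q (m - L.length) := by
      split_ifs with h'
      · obtain rfl : m = L.length := le_antisymm h' hmL
        simpa using h
      · rfl
    have h2 : ¬m + 1 ≤ L.length := by omega
    have h3 : m + 1 - L.length = m - L.length + 1 := by omega
    simp only [h1, h2, h3, if_false, List.getElem_append_right hmL]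
    exact hq _ (by omega)

theorem gammaPrefix_succ (lam : DomPartition n) (j : ℕ) :
    gammaPrefix lam (j + 1) = gammaPrefix lam j ++ gammaCol n (lam.col j) := by
  rw [gammaPrefix, List.range_succ, List.flatMap_append]
  simp [gammaPrefix]

theorem exists_isPath_gammaPrefix (lam : DomPartition n) {U : ℕ → Equiv.Perm (Fin n)} {N : ℕ}
    (hU : ∀ j < N, Reach (gammaCol n (lam.col j)) (U j) (U (j + 1))) :
    ∃ p, IsPath (gammaPrefix lam N) p ∧ ∀ j ≤ N, p (gammaPrefix lam j).length = U j := by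
  induction N with
  | zero =>
    refine ⟨fun _ => U 0, fun m hm => absurd hm (by simp [gammaPrefix]), fun j hj => ?_⟩
    obtain rfl : j = 0 := by omega
    rfl
  | succ N ih =>
    obtain ⟨p, hp, hpU⟩ := ih fun j hj => hU j (by omega)
    obtain ⟨q, hq, hq0, hq1⟩ := (hU N (by omega)).exists_isPath
    rw [gammaPrefix_succ]
    refine ⟨_, hp.append hq ((hpU N le_rfl).trans hq0.symm), fun j hj => ?_⟩
    rcases Nat.lt_or_ge N j with hNj | hNj
    · obtain rfl : j = N + 1 := by omega
      rw [gammaPrefix_succ, List.length_append]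
      split_ifs with h
      · have h0 : (gammaCol n (lam.col N)).length = 0 := by omega
        rw [h0] at hq1 ⊢
        rw [add_zero, hpU N le_rfl, ← hq0, hq1]
      · rw [Nat.add_sub_cancel_left, hq1]
    · rw [if_pos (length_gammaPrefix_mono lam hNj), hpU j hNj]

/-- Every path along `Γ(λ)` that starts at the identity is the chain of an admissible subset. -/
theorem exists_admissible {lam : DomPartition n} {p : ℕ → Equiv.Perm (Fin n)}
    (hp : IsPath (gamma lam) p) (h0 : p 0 = 1) :
    ∃ J, Admissible lam J ∧ ∀ m ≤ (gamma lam).length, chainPerm lam J m = p m := by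
  classical
  refine ⟨Finset.univ.filter fun m => p (m + 1) ≠ p m, ?_⟩
  set J := Finset.univ.filter fun m : Fin (gamma lam).length => p (m + 1) ≠ p m with hJ
  have key : ∀ m ≤ (gamma lam).length, chainPerm lam J m = p m := by
    intro m
    induction m with
    | zero => intro _; exact h0.symm
    | succ m ih =>
      intro hm
      have hm' : m < (gamma lam).length := hm
      rw [chainPerm, dif_pos hm', ih hm'.le]
      by_cases h : p (m + 1) = p m
      · rw [if_neg (by simp [hJ, h]), h]
      · rw [if_pos (by simp [hJ, h])]
        exact ((hp m hm').resolve_left h).1.symm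
  refine ⟨fun m hm => ?_, key⟩
  rw [key _ m.isLt.le, key _ m.isLt]
  exact ((hp m m.isLt).resolve_left (Finset.mem_filter.1 hm).2).2

section Tableau

variable {lam : DomPartition n} (T : SemistandardYoungTableau lam.diagram)

theorem countGE_columnUp_eq_rank {F : Filling} {j : ℕ} {u : Equiv.Perm (Fin n)}
    (h : ∀ p : Fin n, (p : ℕ) < lam.col j → (u p : ℕ) + 1 = F p j) (t : ℕ) :
    countGE (columnUp lam F j) t = rank u (lam.col j) t := by
  rw [countGE, columnUp, List.map_reverse, List.countP_reverse]
  have hc := col_le lam j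
  generalize lam.col j = c at *
  induction c with
  | zero => simp [rank_zero]
  | succ c ih =>
    have h1 := rank_succ u ⟨c, hc⟩ t
    have h2 := h ⟨c, hc⟩ (Nat.lt_succ_self c)
    simp only at h1 h2
    rw [h1, List.range_succ, List.map_append, List.countP_append,
      ih (fun p hp => h p (by omega)) (by omega), h2]
    simp [List.countP_cons]

/-- The state of the greedy construction before the segment of column `j`: the ascents at positions
not separated by the lengths of the columns treated, the initial value `1` for `j = 0`, and
otherwise the previous column of `T` as the first entries. -/
def GreedyState (j : ℕ) (u : Equiv.Perm (Fin n)) : Prop :=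
  (∀ k l : Fin n, k < l → (∀ i < j, ¬((k : ℕ) < lam.col i ∧ lam.col i ≤ (l : ℕ))) → u k < u l) ∧
    (j = 0 → u = 1) ∧
    ∀ i, j = i + 1 → ∀ p : Fin n, (p : ℕ) < lam.col i → (u p : ℕ) + 1 = T p i

theorem exists_greedyState_succ (hT : HasLetters lam T) {j : ℕ} {u : Equiv.Perm (Fin n)}
    (hu : GreedyState T j u) :
    ∃ v, Reach (gammaCol n (lam.col j)) u v ∧ GreedyState T (j + 1) v ∧
      ∀ d, lam.col j ≤ d → d ≤ n → ∀ L : List ℕ, L.Pairwise (· > ·) → L.length = d →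
        (∀ t, countGE L t = rank u d t) →
        ∀ t, countGE ((columnUp lam T j).foldl raise L) t = rank v d t := by
  obtain ⟨hasc, hone, hprev⟩ := hu
  have hmono : ∀ p q, p < q → q < lam.col j → T p j < T q j := fun p q hpq hq =>
    T.col_strict hpq (mem_diagram_iff.2 hq)
  have hle : ∀ p : Fin n, (p : ℕ) < lam.col j → (u p : ℕ) + 1 ≤ T p j := by
    intro p hp
    cases j with
    | zero =>
      rw [hone rfl, Equiv.Perm.one_apply]
      have : ∀ q, q < lam.col 0 → q + 1 ≤ T q 0 := by
        intro q
        induction q with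
        | zero => intro hq; exact (hT 0 0 (mem_diagram_iff.2 hq)).1
        | succ q ih => intro hq; exact (ih (by omega)).trans_lt (hmono q (q + 1) (by omega) hq)
      exact this p hp
    | succ j =>
      rw [hprev j rfl p (hp.trans_le (col_anti lam (Nat.le_succ j)))]
      exact T.row_weak (Nat.lt_succ_self j) (mem_diagram_iff.2 hp)
  obtain ⟨v, hv1, hv2, hv3, hv4⟩ := exists_reach_gammaRows (b := fun p => T p j) (col_le lam j)
    hmono (fun p hp => (hT p j (mem_diagram_iff.2 hp)).2) le_rfl
    (fun p q hpq hq => hasc p q hpq fun i hi hcon => by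
      have := col_anti lam hi.le
      omega)
    hle (fun p hp hp' => absurd hp' (not_lt.2 hp))
  refine ⟨v, hv1, ⟨fun k l hkl hsep => ?_, by simp, fun i hi p hp => ?_⟩, hv4⟩
  · rcases Nat.lt_or_ge k (lam.col j) with hk | hk
    · have hl : (l : ℕ) < lam.col j := by
        have := hsep j (Nat.lt_succ_self j)
        omega
      have := hmono k l hkl hl
      have h1 := hv2 k hk
      have h2 := hv2 l hl
      rw [Fin.lt_def]
      omega
    · exact hv3 k l hkl hk (hasc k l hkl fun i hi => hsep i (by omega))
  · obtain rfl : j = i := by omega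
    exact hv2 p hp

/-- If the initial segments of `u` at the column lengths are dominated by those of `w`, and `u`
increases between them, then all initial segments are dominated. -/
theorem rank_le_of_rank_col_le {u w : Equiv.Perm (Fin n)}
    (hu : ∀ k l : Fin n, k < l →
      (∀ i < lam.numCols, ¬((k : ℕ) < lam.col i ∧ lam.col i ≤ (l : ℕ))) → u k < u l)
    (h : ∀ j < lam.numCols, ∀ t, rank u (lam.col j) t ≤ rank w (lam.col j) t) (d t : ℕ) :
    rank u d t ≤ rank w d t := by
  -- A violation at `d + 1` whose last entry is counted moves on to the right, since the next
  -- entry is larger; it would persist up to the end, where both counts agree.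
  have key : ∀ e d, ∀ hde : d + e = n, ∀ hd : 0 < d, t ≤ (u ⟨d - 1, by omega⟩ : ℕ) + 1 →
      rank u d t ≤ rank w d t := by
    intro e
    induction e with
    | zero =>
      intro d hd _ _
      obtain rfl : d = n := by omega
      exact (rank_top u w t).le
    | succ e ih =>
      intro d hd hpos ht
      by_cases hc : ∃ j < lam.numCols, lam.col j = d
      · obtain ⟨j, hj, rfl⟩ := hc
        exact h j hj t
      · have hlt := hu ⟨d - 1, by omega⟩ ⟨d, by omega⟩ (by rw [Fin.lt_def]; simp only; omega)
          fun i hi hcon => hc ⟨i, hi, by simp only at hcon; omega⟩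
        rw [Fin.lt_def] at hlt
        have h1 := ih (d + 1) (by omega) (by omega) (by simp only [Nat.add_sub_cancel]; omega)
        have h2 := rank_succ u ⟨d, by omega⟩ t
        have h3 := rank_le_add w (Nat.le_succ d) (by omega) t
        rw [if_pos (by omega)] at h2
        simp only [Nat.succ_eq_add_one] at h2 h3
        omega
  rcases Nat.lt_or_ge n d with hd | hd
  · have htop : ∀ x : Equiv.Perm (Fin n), rank x d t = rank x n t := fun x => by
      unfold rank
      congr 1
      refine Finset.filter_congr fun k _ => and_congr_left fun _ => ?_
      have := k.isLt
      omega
    rw [htop, htop]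
    exact (rank_top u w t).le
  · induction d with
    | zero => rw [rank_zero, rank_zero]
    | succ d ih =>
      have h1 := ih (by omega)
      have h2 := rank_succ u ⟨d, hd⟩ t
      have h3 := rank_mono w (Nat.le_succ d) t
      simp only [Nat.succ_eq_add_one] at h2 h3
      split_ifs at h2 with ht
      · exact key (n - (d + 1)) (d + 1) (by omega) (by omega) (by simpa using ht)
      · omega

theorem scanningTableaux_subset (w : Equiv.Perm (Fin n)) :
    scanningTableaux lam w ⊆ alcoveTableaux lam w := by
  rintro _ ⟨T, rfl, hT, hle⟩
  have hF : ∀ j, (columnUp lam T j).Pairwise (· > ·) := pairwise_columnUp T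
  rw [fillingLE_scanningTableau_iff hF] at hle
  have hstep : ∀ j u, ∃ v, GreedyState T j u → Reach (gammaCol n (lam.col j)) u v ∧
      GreedyState T (j + 1) v ∧
      ∀ d, lam.col j ≤ d → d ≤ n → ∀ L : List ℕ, L.Pairwise (· > ·) → L.length = d →
        (∀ t, countGE L t = rank u d t) →
        ∀ t, countGE ((columnUp lam T j).foldl raise L) t = rank v d t := by
    intro j u
    by_cases hu : GreedyState T j u
    · obtain ⟨v, hv⟩ := exists_greedyState_succ T hT hu
      exact ⟨v, fun _ => hv⟩
    · exact ⟨u, fun h => absurd h hu⟩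
  choose f hf using hstep
  let U : ℕ → Equiv.Perm (Fin n) := fun j => Nat.rec 1 f j
  have hU : ∀ j, GreedyState T j (U j) := by
    intro j
    induction j with
    | zero => exact ⟨fun k l hkl _ => hkl, fun _ => rfl, fun i hi => by omega⟩
    | succ j ih => exact (hf j (U j) ih).2.1
  have hcol : ∀ j t, countGE (columnUp lam T j) t = rank (U (j + 1)) (lam.col j) t := fun j =>
    countGE_columnUp_eq_rank ((hU (j + 1)).2.2 j rfl)
  have hscan : ∀ j k t, countGE (partialScan lam T j k) t =
      rank (U (j + 1 + k)) (lam.col j) t := by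
    intro j k
    induction k with
    | zero => exact hcol j
    | succ k ih =>
      rw [partialScan_succ hF]
      exact (hf _ _ (hU (j + 1 + k))).2.2 (lam.col j) (col_anti lam (by omega)) (col_le lam j)
        _ (pairwise_partialScan hF j k) (length_partialScan hF j k) ih
  obtain ⟨p, hp, hpU⟩ := exists_isPath_gammaPrefix lam (U := U) (N := lam.numCols)
    fun j _ => (hf j (U j) (hU j)).1
  obtain ⟨J, hJ, hJp⟩ := exists_admissible (lam := lam) hp (hpU 0 (Nat.zero_le _))
  have hseg : ∀ j ≤ lam.numCols, chainPerm lam J (gammaPrefix lam j).length = U j := fun j hj =>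
    (hJp _ (length_gammaPrefix_mono lam hj)).trans (hpU j hj)
  refine ⟨J, ⟨hJ, bruhatLE_of_rank_le fun d t => ?_⟩, ?_⟩
  · rw [gamma, hseg _ le_rfl]
    refine rank_le_of_rank_col_le (hU lam.numCols).1 (fun j hj t => ?_) d t
    have h1 := hscan j (lam.numCols - (j + 1)) t
    rw [show j + 1 + (lam.numCols - (j + 1)) = lam.numCols by omega] at h1
    exact h1 ▸ hle j t
  · funext i j
    by_cases hij : (i, j) ∈ lam.diagram
    · have hi := mem_diagram_iff.1 hij
      have hj := lt_numCols hi
      refine eq_of_forall_gt_iff fun t => ?_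
      rw [tableauOf_lt_iff hi, segPerm, hseg (j + 1) hj, ← hcol]
      have h1 := getD_lt_iff (hF j) (k := lam.col j - 1 - i) (by simp; omega) t
      have h2 : (columnUp lam T j).getD (lam.col j - 1 - i) 0 = T i j := by
        rw [List.getD_eq_getElem _ _ (by simp; omega)]
        simp only [columnUp, List.getElem_map, List.getElem_reverse, List.length_range,
          List.getElem_range]
        rw [show lam.col j - 1 - (lam.col j - 1 - i) = i by omega]
      rw [h2] at h1
      rw [h1]
      omega
    · rw [tableauOf, if_neg hij, T.zeros hij]

end Tableau

end Demazure

theorem mainTheorem6 (n : ℕ) (hn : 0 < n) (lam : Demazure.DomPartition n)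
    (w : Equiv.Perm (Fin n)) (hw : w ∈ Demazure.minReps lam) :
    Demazure.demazureTableaux lam w = Demazure.alcoveTableaux lam w ∧
      Demazure.scanningTableaux lam w = Demazure.alcoveTableaux lam w := by
  have h : Demazure.demazureTableaux lam w = Demazure.scanningTableaux lam w := by
    ext F
    constructor <;> rintro ⟨T, rfl, hT, hle⟩ <;> refine ⟨T, rfl, hT, ?_⟩
    · rwa [← Demazure.rightKey_eq_scanningTableau]
    · rwa [Demazure.rightKey_eq_scanningTableau]
  rw [h]
  exact ⟨(Demazure.scanningTableaux_subset w).antisymm (Demazure.alcoveTableaux_subset w),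
    (Demazure.scanningTableaux_subset w).antisymm (Demazure.alcoveTableaux_subset w)⟩
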